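/- **Conventions.** Each of the three games is taken with a single player, without turn limit, and on the infinite hexagonal map $\mathbb Z^2$ (axial coordinates, six neighbours per tile); all tiles are flat and traversable, and a unit moves one hex per turn. A *game state* is a finite record of the position (listed below). Each turn the player gives orders; orders that the rules do not permit cannot be given. * **Civ:BE.** A state records which tiles are desert, which are owned by the player's Cities, which are worked by Citizens, whether the player has the Terraforming technology and the Ecoscaping civic, which improvement (Road, Pillaged Road, Terrascape) each tile has (finitely many tiles have one), and two Workers and a Rover. A Worker may move, build a Road on any unimproved tile, build a Terrascape on an owned unimproved desert tile (with Terraforming), remove an improvement (one turn), or repair a Pillaged Road (one turn); the Rover may move or pillage a Road outside the player's borders. Building a Road or a Terrascape takes fixed numbers of turns. The Culture yield is $C_t=C_*+(y+e)\cdot\#\{\text{worked Terrascapes}\}$, with constants $C_*,y\in\mathbb N$ and $e=1$ if the player has Ecoscaping, $e=0$ otherwise. *Observed:* $C_t-C_*$ and the improvement under the tape Worker. * **Civ:V.** A state records the owned tiles, whether the player has Engineering, the improvements (Road, Railroad; finitely many), and two Workers. A Worker may move, build a Road or (with Engineering) a Railroad on any unimproved tile, each in a fixed number of turns, or remove one in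 one turn. *Observed:* the number of Railroads on owned tiles and the improvement under the tape Worker. * **Civ:VI.** The map is a strip of grassland (Food $2$) surrounded by floodplains (Food $3$). A state records finitely many Cities, the tiles with a Monastery and those with a Farm, a Worker (which only marks a position), and possibly a Settler. A City has a tile, a set of owned tiles, a population (one Citizen works the City itself, the others work distinct other owned tiles), stored Food, and possibly a growth cap set by the player. The player may reassign Citizens within a City, cap a City's growth, let a City with at least two Citizens train a Settler (cost $30\cdot\#\text{Cities}+50$ at a fixed positive Production per turn; the City loses one Citizen), and found a City with the Settler on an unowned tile at distance at least $4$ from all other Cities; the new City owns its tile and the adjacent unowned ones and starts with two Citizens. A City produces $2$ Food plus that of its own terrain and of its worked tiles (a Farm adds $1$); each Citizen consumes $2$. A City below its cap stores the surplus and gains a Citizen when it has stored a given amount depending on its population. New Citizens work the free tile of highest combined yield. The Faith yield is $F_t=F_*+2\cdot\#\{\text{worked Monasteries}\}$. *Observed:* $F_t-F_*$, whether the Worker's tile is being worked, the population of the City owning that tile and the Worker's position relative to that City, and whether there is a Settler. A state is *valid* if it is consistent with these rules (with no construction under way in Civ:BE and Civ:V). A *command table* is a finite table that assigns to observations finite sequences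 of orders for consecutive turns; an observation without entry means HALT. *Following* a table from a state means: observe, carry out the listed orders, observe again, and so on; this *halts* if every order on the way is permitted and an observation that means HALT is reached after finitely many turns. **Corollary (undecidability).** For each of Civ:BE, Civ:V and Civ:VI, and for all values of the constants of the game, there is a single command table $T$ such that 1. following $T$, the game simulates a universal Turing machine: there is a computable map that sends a program $c$ (of a partial recursive function) and an input $n\in\mathbb N$ to a valid game state $s_{c,n}$ such that following $T$ from $s_{c,n}$ halts if and only if the computation of $c$ on $n$ halts; and 2. the game is undecidable: no algorithm decides, given a valid game state $s$, whether following $T$ from $s$ halts. -/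

import Mathlib

/-! ### Turn-based single-player games and play according to a command table -/

/-- A single-player turn-based game. `turn s o` is the state after one turn in which the player
gives the orders `o`, or `none` if the rules do not permit these orders in state `s`.
There is no turn limit. `observe` is what the player reads off the screen before issuing a
command. `Valid` singles out the states that are consistent with the rules. -/
structure CivGame (State Order Obs : Type) where
  turn : State → Order → Option State
  observe : State → Obs
  Valid : State → Prop

/-- A finite command table: what is observed determines a finite list of orders, to be carried
out on consecutive turns. An observation without an entry means `HALT`. -/
abbrev CommandTable (Obs Order : Type) := List (Obs × List Order)

namespace CivGame

variable {State Order Obs : Type} [DecidableEq Obs]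

/-- One command of the table, carried out in full by legal turns of the game, leads from `s`
to `s'`. -/
def Round (G : CivGame State Order Obs) (T : CommandTable Obs Order) (s s' : State) : Prop :=
  ∃ os : List Order, T.lookup (G.observe s) = some os ∧ os.foldlM G.turn s = some s'

/-- Starting in state `s` and following the table `T`, the player reaches, after finitely many
turns, a state in which the table says `HALT`. -/
def Halts (G : CivGame State Order Obs) (T : CommandTable Obs Order) (s : State) : Prop :=
  ∃ s' : State, Relation.ReflTransGen (G.Round T) s s' ∧ T.lookup (G.observe s') = none

/-- Under the fixed table `T` the game simulates every machine: a program `c` and an input `n` can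
be effectively turned into a valid game state from which the play halts if and only if the
computation of `c` on `n` does. -/
def SimulatesUniversal [Primcodable State] (G : CivGame State Order Obs)
    (T : CommandTable Obs Order) : Prop :=
  ∃ enc : Nat.Partrec.Code → ℕ → State, Computable₂ enc ∧
    ∀ c n, G.Valid (enc c n) ∧ (G.Halts T (enc c n) ↔ (c.eval n).Dom)

/-- No algorithm decides, given a valid game state, whether the play according to `T` halts. -/
def UndecidableUnder [Primcodable State] (G : CivGame State Order Obs)
    (T : CommandTable Obs Order) : Prop :=
  ¬ ∃ f : State → Bool, Computable f ∧ ∀ s, G.Valid s → (f s = true ↔ G.Halts T s)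

end CivGame

/-! ### The infinite hexagonal map -/

/-- The tiles of the map, in axial coordinates. The map is infinite in every direction. -/
abbrev Hex := ℤ × ℤ

/-- The six directions on the hexagonal map. -/
inductive HexDir
  | east | west | northEast | northWest | southEast | southWest
  deriving DecidableEq

/-- The step to the adjacent tile in a direction. -/
def HexDir.vec : HexDir → Hex
  | east => (1, 0)
  | west => (-1, 0)
  | northEast => (1, -1)
  | northWest => (0, -1)
  | southEast => (0, 1)
  | southWest => (-1, 1)

namespace Hex

/-- The number of steps between two tiles. -/
def dist (a b : Hex) : ℕ :=
  max (max (a.1 - b.1).natAbs (a.2 - b.2).natAbs) ((a.1 - b.1) + (a.2 - b.2)).natAbs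

/-- The six tiles adjacent to a tile. -/
def neighbors (h : Hex) : List Hex :=
  [HexDir.east, .west, .northEast, .northWest, .southEast, .southWest].map fun d => h + d.vec

end Hex

/-- A Worker: its position, and the construction under way on its tile, if any, with the number
of turns already spent on it. -/
structure Worker (Project : Type) where
  pos : Hex
  job : Option (Project × ℕ)

/-- Workers as tuples. -/
def Worker.equiv (Project : Type) : Worker Project ≃ Hex × Option (Project × ℕ) where
  toFun w := (w.pos, w.job)
  invFun t := ⟨t.1, t.2⟩
  left_inv _ := rfl
  right_inv _ := rfl

instance {Project : Type} [Primcodable Project] : Primcodable (Worker Project) :=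
  Primcodable.ofEquiv _ (Worker.equiv Project)

/-- One more turn of work on project `p`, which costs `cost` turns: the new state of the Worker,
and whether the project is now complete. -/
def Worker.work {Project : Type} [DecidableEq Project] (w : Worker Project) (p : Project)
    (cost : ℕ) : Worker Project × Bool :=
  let spent := match w.job with
    | some (p', k) => if p' = p then k + 1 else 1
    | none => 1
  if cost ≤ spent then (⟨w.pos, none⟩, true) else (⟨w.pos, some (p, spent)⟩, false)

/-- Moving to an adjacent tile, which takes a turn and abandons any construction under way. -/
def Worker.move {Project : Type} (w : Worker Project) (d : HexDir) : Worker Project :=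
  ⟨w.pos + d.vec, none⟩

/-! ### Civ:BE -/

namespace CivBE

/-- Constants of the game: the number of turns it takes to build a Terrascape and a Road, the
Culture yield of a Terrascape without the Ecoscaping civic, and the base Culture per turn. -/
structure Rules where
  terrascapeTurns : ℕ
  roadTurns : ℕ
  terrascapeCulture : ℕ
  baseCulture : ℕ

/-- What can be on a tile. -/
inductive Improvement
  | unimproved | road | pillagedRoad | terrascape
  deriving DecidableEq

/-- What a Worker can build. -/
inductive Project
  | road | terrascape
  deriving DecidableEq

/-- Numbering of the improvements. -/
def Improvement.equiv : Improvement ≃ Fin 4 where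
  toFun
    | .unimproved => 0
    | .road => 1
    | .pillagedRoad => 2
    | .terrascape => 3
  invFun
    | 0 => .unimproved
    | 1 => .road
    | 2 => .pillagedRoad
    | 3 => .terrascape
  left_inv i := by cases i <;> rfl
  right_inv i := by fin_cases i <;> rfl

instance : Primcodable Improvement := Primcodable.ofEquiv _ Improvement.equiv

/-- Numbering of the projects. -/
def Project.equiv : Project ≃ Bool where
  toFun
    | .road => false
    | .terrascape => true
  invFun
    | false => .road
    | true => .terrascape
  left_inv i := by cases i <;> rfl
  right_inv i := by cases i <;> rfl

instance : Primcodable Project := Primcodable.ofEquiv _ Project.equiv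

/-- A state of the game. The tiles in `desert` are flat desert, all others are flat and
traversable; `owned` are the tiles of the player's Cities, `worked` those on which a
Citizen works; `improved` records the improvements (the first entry of a tile counts, a tile without
entry is unimproved); `terraforming` and `ecoscaping` say whether the player has that technology
and that civic. The units are two Workers and a Rover. -/
structure State where
  desert : List Hex
  owned : List Hex
  worked : List Hex
  terraforming : Bool
  ecoscaping : Bool
  improved : List (Hex × Improvement)
  stateWorker : Worker Project
  tapeWorker : Worker Project
  rover : Hex

/-- States as tuples. -/
def State.equiv : State ≃ List Hex × List Hex × List Hex × Bool × Bool ×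
    List (Hex × Improvement) × Worker Project × Worker Project × Hex where
  toFun s := (s.desert, s.owned, s.worked, s.terraforming, s.ecoscaping, s.improved,
    s.stateWorker, s.tapeWorker, s.rover)
  invFun t := ⟨t.1, t.2.1, t.2.2.1, t.2.2.2.1, t.2.2.2.2.1, t.2.2.2.2.2.1, t.2.2.2.2.2.2.1,
    t.2.2.2.2.2.2.2.1, t.2.2.2.2.2.2.2.2⟩
  left_inv _ := rfl
  right_inv _ := rfl

instance : Primcodable State := Primcodable.ofEquiv _ State.equiv

/-- The improvement on a tile. -/
def State.improvementAt (s : State) (h : Hex) : Improvement :=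
  (s.improved.lookup h).getD .unimproved

/-- Change the improvement on a tile. -/
def State.setImprovement (s : State) (h : Hex) (i : Improvement) : State :=
  { s with improved := (h, i) :: s.improved }

/-- The Culture yield per turn: every worked Terrascape counts, and Ecoscaping gives `+1` for each. -/
def State.culture (r : Rules) (s : State) : ℕ :=
  r.baseCulture + (r.terrascapeCulture + if s.ecoscaping then 1 else 0) *
    s.worked.countP fun h => s.improvementAt h = .terrascape

/-- Orders to a Worker for one turn. -/
inductive WorkerOrder
  | wait
  | move (d : HexDir)
  | build (p : Project)
  | remove
  | repair

/-- Orders to the Rover for one turn. -/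
inductive RoverOrder
  | wait
  | move (d : HexDir)
  | pillage

/-- One turn of a Worker. Roads can be built on any unimproved tile; Terrascapes on the player's
unimproved desert tiles if Terraforming is known. Removing an improvement and repairing
a pillaged Road take one turn. -/
def workerTurn (r : Rules) (s : State) (w : Worker Project) :
    WorkerOrder → Option (State × Worker Project)
  | .wait => some (s, w)
  | .move d => some (s, w.move d)
  | .build .road =>
      if s.improvementAt w.pos = .unimproved then
        let x := w.work .road r.roadTurns
        some (if x.2 then s.setImprovement w.pos .road else s, x.1)
      else none
  | .build .terrascape =>
      if s.improvementAt w.pos = .unimproved ∧ w.pos ∈ s.owned ∧ w.pos ∈ s.desert ∧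
          s.terraforming = true then
        let x := w.work .terrascape r.terrascapeTurns
        some (if x.2 then s.setImprovement w.pos .terrascape else s, x.1)
      else none
  | .remove =>
      if s.improvementAt w.pos ≠ .unimproved then
        some (s.setImprovement w.pos .unimproved, ⟨w.pos, none⟩)
      else none
  | .repair =>
      if s.improvementAt w.pos = .pillagedRoad then
        some (s.setImprovement w.pos .road, ⟨w.pos, none⟩)
      else none

/-- One turn of the Rover. Roads can be pillaged outside the player's own borders. -/
def roverTurn (s : State) : RoverOrder → Option State
  | .wait => some s
  | .move d => some { s with rover := s.rover + d.vec }
  | .pillage =>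
      if s.improvementAt s.rover = .road ∧ s.rover ∉ s.owned then
        some (s.setImprovement s.rover .pillagedRoad)
      else none

/-- The orders for one turn. -/
structure Order where
  stateWorker : WorkerOrder
  tapeWorker : WorkerOrder
  rover : RoverOrder

/-- One turn of the game. -/
def turn (r : Rules) (s : State) (o : Order) : Option State := do
  let (s, w) ← workerTurn r s s.stateWorker o.stateWorker
  let s := { s with stateWorker := w }
  let (s, w) ← workerTurn r s s.tapeWorker o.tapeWorker
  let s := { s with tapeWorker := w }
  roverTurn s o.rover

/-- What the command table refers to: the change of the Culture yield relative to the base yield,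
and the improvement on the tile of the tape Worker. -/
def observe (r : Rules) (s : State) : ℕ × Improvement :=
  (s.culture r - r.baseCulture, s.improvementAt s.tapeWorker.pos)

/-- Consistency of a game state: Citizens work only tiles of the player's Cities, at most one per
tile, Terrascapes stand only on the player's desert tiles, pillaged Roads only outside the
player's borders, and no construction is under way. -/
structure Valid (s : State) : Prop where
  worked_nodup : s.worked.Nodup
  worked_owned : ∀ h ∈ s.worked, h ∈ s.owned
  terrascape : ∀ h, s.improvementAt h = .terrascape → h ∈ s.owned ∧ h ∈ s.desert
  pillaged : ∀ h, s.improvementAt h = .pillagedRoad → h ∉ s.owned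
  stateWorker_idle : s.stateWorker.job = none
  tapeWorker_idle : s.tapeWorker.job = none

/-- Single-player Civ:BE on the infinite map without turn limit. -/
def game (r : Rules) : CivGame State Order (ℕ × Improvement) where
  turn := turn r
  observe := observe r
  Valid := Valid

end CivBE

/-! ### Civ:V -/

namespace CivV

/-- Constants of the game: the number of turns it takes to build a Road and a Railroad. -/
structure Rules where
  roadTurns : ℕ
  railroadTurns : ℕ

/-- What can be on a tile. -/
inductive Improvement
  | unimproved | road | railroad
  deriving DecidableEq

/-- What a Worker can build. -/
inductive Project
  | road | railroad
  deriving DecidableEq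

/-- Numbering of the improvements. -/
def Improvement.equiv : Improvement ≃ Fin 3 where
  toFun
    | .unimproved => 0
    | .road => 1
    | .railroad => 2
  invFun
    | 0 => .unimproved
    | 1 => .road
    | 2 => .railroad
  left_inv i := by cases i <;> rfl
  right_inv i := by fin_cases i <;> rfl

instance : Primcodable Improvement := Primcodable.ofEquiv _ Improvement.equiv

/-- Numbering of the projects. -/
def Project.equiv : Project ≃ Bool where
  toFun
    | .road => false
    | .railroad => true
  invFun
    | false => .road
    | true => .railroad
  left_inv i := by cases i <;> rfl
  right_inv i := by cases i <;> rfl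

instance : Primcodable Project := Primcodable.ofEquiv _ Project.equiv

/-- A state of the game. All tiles are flat and traversable; `owned` are the tiles of the player's
Cities; `improved` records the improvements (the first entry of a tile counts, a tile
without entry is unimproved); `engineering` says whether the player has that technology. The units
are two Workers. -/
structure State where
  owned : List Hex
  engineering : Bool
  improved : List (Hex × Improvement)
  stateWorker : Worker Project
  tapeWorker : Worker Project

/-- States as tuples. -/
def State.equiv : State ≃ List Hex × Bool × List (Hex × Improvement) ×
    Worker Project × Worker Project where
  toFun s := (s.owned, s.engineering, s.improved, s.stateWorker, s.tapeWorker)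
  invFun t := ⟨t.1, t.2.1, t.2.2.1, t.2.2.2.1, t.2.2.2.2⟩
  left_inv _ := rfl
  right_inv _ := rfl

instance : Primcodable State := Primcodable.ofEquiv _ State.equiv

/-- The improvement on a tile. -/
def State.improvementAt (s : State) (h : Hex) : Improvement :=
  (s.improved.lookup h).getD .unimproved

/-- Change the improvement on a tile. -/
def State.setImprovement (s : State) (h : Hex) (i : Improvement) : State :=
  { s with improved := (h, i) :: s.improved }

/-- The number of Railroads in the player's territory. -/
def State.railroads (s : State) : ℕ :=
  s.owned.countP fun h => s.improvementAt h = .railroad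

/-- Orders to a Worker for one turn. -/
inductive WorkerOrder
  | wait
  | move (d : HexDir)
  | build (p : Project)
  | remove

/-- One turn of a Worker. Roads and, with Engineering, Railroads can be built on any unimproved
tile (an existing one has to be removed first); removing takes one turn. -/
def workerTurn (r : Rules) (s : State) (w : Worker Project) :
    WorkerOrder → Option (State × Worker Project)
  | .wait => some (s, w)
  | .move d => some (s, w.move d)
  | .build .road =>
      if s.improvementAt w.pos = .unimproved then
        let x := w.work .road r.roadTurns
        some (if x.2 then s.setImprovement w.pos .road else s, x.1)
      else none
  | .build .railroad =>
      if s.improvementAt w.pos = .unimproved ∧ s.engineering = true then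
        let x := w.work .railroad r.railroadTurns
        some (if x.2 then s.setImprovement w.pos .railroad else s, x.1)
      else none
  | .remove =>
      if s.improvementAt w.pos ≠ .unimproved then
        some (s.setImprovement w.pos .unimproved, ⟨w.pos, none⟩)
      else none

/-- The orders for one turn. -/
structure Order where
  stateWorker : WorkerOrder
  tapeWorker : WorkerOrder

/-- One turn of the game. -/
def turn (r : Rules) (s : State) (o : Order) : Option State := do
  let (s, w) ← workerTurn r s s.stateWorker o.stateWorker
  let s := { s with stateWorker := w }
  let (s, w) ← workerTurn r s s.tapeWorker o.tapeWorker
  pure { s with tapeWorker := w }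

/-- What the command table refers to: the number of Railroads in the player's territory, and the
improvement on the tile of the tape Worker. -/
def observe (s : State) : ℕ × Improvement :=
  (s.railroads, s.improvementAt s.tapeWorker.pos)

/-- Consistency of a game state: every owned tile is listed once, and no construction is under
way. -/
structure Valid (s : State) : Prop where
  owned_nodup : s.owned.Nodup
  stateWorker_idle : s.stateWorker.job = none
  tapeWorker_idle : s.tapeWorker.job = none

/-- Single-player Civ:V on the infinite map without turn limit. -/
def game (r : Rules) : CivGame State Order (ℕ × Improvement) where
  turn := turn r
  observe := observe
  Valid := Valid

end CivV

/-! ### Civ:VI -/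

namespace CivVI

/-- Constants of the game: the Food a City of a given population has to store in order to grow, the
Production of a City per turn, and the base Faith per turn. -/
structure Rules where
  growthFood : ℕ → ℕ
  production : ℕ
  production_pos : 0 < production
  baseFaith : ℕ

/-- A City: the tile on which it stands, the tiles it owns, its population, the tiles on which its
Citizens work (besides the one who always works the City itself), the stored Food, the cap that the
player has put on its growth (if any), and the Production already put into a Settler. -/
structure City where
  center : Hex
  tiles : List Hex
  population : ℕ
  worked : List Hex
  food : ℕ
  cap : Option ℕ
  settlerProgress : ℕ

/-- Cities as tuples. -/
def City.equiv : City ≃ Hex × List Hex × ℕ × List Hex × ℕ × Option ℕ × ℕ where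
  toFun c := (c.center, c.tiles, c.population, c.worked, c.food, c.cap, c.settlerProgress)
  invFun t := ⟨t.1, t.2.1, t.2.2.1, t.2.2.2.1, t.2.2.2.2.1, t.2.2.2.2.2.1, t.2.2.2.2.2.2⟩
  left_inv _ := rfl
  right_inv _ := rfl

instance : Primcodable City := Primcodable.ofEquiv _ City.equiv

/-- A state of the game: the Cities, the tiles with a Monastery, the tiles with a Farm, the position
of the Worker, and that of the Settler waiting to found a City, if there is one. -/
structure State where
  cities : List City
  monasteries : List Hex
  farms : List Hex
  worker : Hex
  settler : Option Hex

/-- States as tuples. -/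
def State.equiv : State ≃ List City × List Hex × List Hex × Hex × Option Hex where
  toFun s := (s.cities, s.monasteries, s.farms, s.worker, s.settler)
  invFun t := ⟨t.1, t.2.1, t.2.2.1, t.2.2.2.1, t.2.2.2.2⟩
  left_inv _ := rfl
  right_inv _ := rfl

instance : Primcodable State := Primcodable.ofEquiv _ State.equiv

/-- The map: a single infinite strip of grassland, and floodplains everywhere else. -/
def IsGrassland (h : Hex) : Prop := h.2 = 0

instance (h : Hex) : Decidable (IsGrassland h) := inferInstanceAs (Decidable (h.2 = 0))

/-- The Food yield of the terrain of a tile. -/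
def terrainFood (h : Hex) : ℕ := if IsGrassland h then 2 else 3

/-- The Food yield of a worked tile; a Farm adds `1`. -/
def State.tileFood (s : State) (h : Hex) : ℕ := terrainFood h + if h ∈ s.farms then 1 else 0

/-- The Faith yield of a worked tile. -/
def State.tileFaith (s : State) (h : Hex) : ℕ := if h ∈ s.monasteries then 2 else 0

/-- The Faith yield per turn. -/
def State.faith (r : Rules) (s : State) : ℕ :=
  r.baseFaith + (s.cities.map fun c => (c.worked.map s.tileFaith).sum).sum

/-- The Food a City produces per turn: `2` and the terrain of its own tile, and the worked tiles. -/
def State.cityFood (s : State) (c : City) : ℕ :=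
  2 + terrainFood c.center + (c.worked.map s.tileFood).sum

/-- A new Citizen works the free tile of the City with the highest combined yield (and none if no
tile is free). -/
def State.placeCitizen (s : State) (c : City) : City :=
  match (c.tiles.filter fun h => h ≠ c.center ∧ h ∉ c.worked).argmax
      (fun h => s.tileFood h + s.tileFaith h) with
  | some h => { c with worked := h :: c.worked }
  | none => c

/-- The end of a turn for a City. Unless its growth is capped, it stores the Food left over after
every Citizen has consumed `2`, and grows by one Citizen when it has stored enough. -/
def State.grow (r : Rules) (s : State) (c : City) : City :=
  if ∃ k ∈ c.cap, k ≤ c.population then c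
  else
    let f := c.food + (s.cityFood c - 2 * c.population)
    if r.growthFood c.population ≤ f then
      s.placeCitizen { c with population := c.population + 1,
                              food := f - r.growthFood c.population }
    else { c with food := f }

/-- The City that owns a tile. -/
def State.cityAt (s : State) (h : Hex) : Option City := s.cities.find? fun c => h ∈ c.tiles

/-- Replace a City, identified by the tile on which it stands. -/
def State.setCity (s : State) (c : City) : State :=
  { s with cities := s.cities.map fun d => if d.center = c.center then c else d }

/-- In orders, a tile is given by its coordinates or by its offset from the Worker. -/
inductive TileRef
  | absolute (h : Hex)
  | fromWorker (v : Hex)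

/-- The tile referred to. -/
def State.tile (s : State) : TileRef → Hex
  | .absolute h => h
  | .fromWorker v => s.worker + v

/-- Orders to a Settler for one turn. -/
inductive SettlerOrder
  | move (d : HexDir)
  | found

/-- One turn of the Settler. A City is founded on a tile that no City owns, at least `4` hexes away
from all other Cities. It takes the place of the Settler and owns its tile and the
adjacent ones that no City owns yet. It starts with two Citizens: one works the City itself, the
other the tile with the highest combined yield. -/
def settlerTurn (s : State) : SettlerOrder → Option State
  | .move d => do
      let p ← s.settler
      pure { s with settler := some (p + d.vec) }
  | .found => do
      let p ← s.settler
      if s.cityAt p = none ∧ ∀ c ∈ s.cities, 4 ≤ Hex.dist p c.center then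
        let c : City :=
          { center := p
            tiles := p :: (Hex.neighbors p).filter fun h => (s.cityAt h).isNone
            population := 2, worked := [], food := 0, cap := none, settlerProgress := 0 }
        pure { s with cities := s.placeCitizen c :: s.cities, settler := none }
      else none

/-- Move the Citizen working on tile `a` to a free tile `b` of the same City. -/
def reassign (s : State) (a b : Hex) : Option State := do
  let c ← s.cityAt a
  if a ∈ c.worked ∧ b ∈ c.tiles ∧ b ∉ c.worked ∧ b ≠ c.center then
    pure (s.setCity { c with worked := b :: c.worked.erase a })
  else none

/-- Put a cap on the growth of the City that owns tile `a`. -/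
def setCap (s : State) (a : Hex) (k : ℕ) : Option State := do
  let c ← s.cityAt a
  pure (s.setCity { c with cap := some k })

/-- The Production needed for a Settler, which increases with the number of Cities. -/
def State.settlerCost (s : State) : ℕ := 30 * s.cities.length + 50

/-- For one turn, the City that owns tile `a` trains a Settler. The City needs at least two Citizens.
When the Settler is finished it appears in the City, and the City loses the Citizen working on
tile `b`. There is at most one Settler at a time. -/
def train (r : Rules) (s : State) (a b : Hex) : Option State := do
  let c ← s.cityAt a
  if 2 ≤ c.population ∧ b ∈ c.worked ∧ s.settler = none then
    if s.settlerCost ≤ c.settlerProgress + r.production then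
      pure { s.setCity { c with population := c.population - 1, worked := c.worked.erase b,
                                settlerProgress := 0 } with
             settler := some c.center }
    else
      pure (s.setCity { c with settlerProgress := c.settlerProgress + r.production })
  else none

/-- The orders for one turn: a move of the Worker, an order to the Settler, reassignments of
Citizens, caps on the growth of Cities, and the training of a Settler. -/
structure Order where
  worker : Option HexDir
  settler : Option SettlerOrder
  citizens : List (TileRef × TileRef)
  caps : List (TileRef × ℕ)
  train : Option (TileRef × TileRef)

/-- One turn of the game: the orders are carried out, then the Cities grow. -/
def turn (r : Rules) (s : State) (o : Order) : Option State := do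
  let s := match o.worker with
    | some d => { s with worker := s.worker + d.vec }
    | none => s
  let s ← match o.settler with
    | some x => settlerTurn s x
    | none => some s
  let s ← o.citizens.foldlM (fun s x => reassign s (s.tile x.1) (s.tile x.2)) s
  let s ← o.caps.foldlM (fun s x => setCap s (s.tile x.1) x.2) s
  let s ← match o.train with
    | some x => CivVI.train r s (s.tile x.1) (s.tile x.2)
    | none => some s
  pure { s with cities := s.cities.map (s.grow r) }

/-- What the command table refers to: the change of the Faith yield relative to the base yield,
whether the tile of the Worker is being worked, the population of the City that owns this tile and
the position of the Worker relative to that City, and whether there is a Settler. -/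
structure Obs where
  faith : ℕ
  isWorked : Bool
  city : Option (ℕ × Hex)
  settler : Bool
  deriving DecidableEq

/-- What the player observes. -/
def observe (r : Rules) (s : State) : Obs where
  faith := s.faith r - r.baseFaith
  isWorked := s.cities.any fun c => s.worker ∈ c.worked
  city := (s.cityAt s.worker).map fun c => (c.population, s.worker - c.center)
  settler := s.settler.isSome

/-- Consistency of a City: it owns its own tile and further tiles at distance at most `3`; one
Citizen works the City itself, and the others work distinct other tiles owned by the City. -/
structure City.Valid (c : City) : Prop where
  center_mem : c.center ∈ c.tiles
  tiles_nodup : c.tiles.Nodup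
  tiles_dist : ∀ h ∈ c.tiles, Hex.dist h c.center ≤ 3
  worked_nodup : c.worked.Nodup
  worked_tiles : ∀ h ∈ c.worked, h ∈ c.tiles ∧ h ≠ c.center
  population_eq : c.population = c.worked.length + 1

/-- Consistency of a game state: the Cities are consistent, at least `4` hexes apart, and
own disjoint sets of tiles; Monasteries and Farms are on different tiles, off the grassland strip,
that are owned by the player and do not carry a City. -/
structure Valid (s : State) : Prop where
  cities_valid : ∀ c ∈ s.cities, c.Valid
  cities_pairwise : s.cities.Pairwise fun c d =>
    4 ≤ Hex.dist c.center d.center ∧ c.tiles.Disjoint d.tiles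
  disjoint : s.monasteries.Disjoint s.farms
  improved : ∀ h, h ∈ s.monasteries ∨ h ∈ s.farms →
    ¬ IsGrassland h ∧ ∃ c ∈ s.cities, h ∈ c.tiles ∧ h ≠ c.center

/-- Single-player Civ:VI on the infinite map without turn limit. -/
def game (r : Rules) : CivGame State Order Obs where
  turn := turn r
  observe := observe r
  Valid := Valid

end CivVI

/-!
Mathlib compiles a partial recursive function to a Turing machine with one tape over a finite
alphabet. Applied to a universal function, with the symbols encoded as binary words, this yields a
fixed machine over `Bool` with finitely many states whose halting problem is that of all programs.
A game simulates any such machine if its observation shows the state of the machine and the symbol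
under the head: a table with one entry for each pair of a state and a symbol then carries out the
steps of the machine. Undecidability follows, since a decision procedure for the game would decide
the halting problem.

In all three games the yield that the player observes encodes the state of the machine, in unary.
In Civ:BE and Civ:V the yield counts the Terrascapes or Railroads which one Worker builds on a strip
of owned tiles, and the tape is a row of Roads and unimproved tiles under the other Worker.

In Civ:VI the yield counts the Monasteries worked by the Citizens of a fixed row of Cities. The tape
is a row of Cities on the grassland strip, each of which shows a symbol by the choice of its free
Citizen between two tiles. The tape is potentially infinite only because it is extended on demand:
when the Worker arrives at a position without a City, it goes back to the last City, which trains a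
Settler. The Settler founds the missing City, and then the last City regrows its free Citizen and
shows its symbol again, which the yield has recorded in the meantime. Growth caps make sure that
no City grows at any other time.
-/

section Machines

open Turing StateTransition

theorem exists_fin_machine {Γ Λ : Type*} [Inhabited Γ] [Inhabited Λ] (M : TM0.Machine Γ Λ)
    (S : Finset Λ) (hS : TM0.Supports M (S : Set Λ)) :
    ∃ (n : ℕ) (M' : TM0.Machine Γ (Fin (n + 1))),
      ∀ l, (TM0.eval M' l).Dom ↔ (TM0.eval M l).Dom := by
  classical
  let start : S := ⟨default, hS.1⟩
  obtain ⟨n, hn⟩ : ∃ n, Fintype.card S = n + 1 :=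
    Nat.exists_eq_succ_of_ne_zero (@Fintype.card_ne_zero S _ ⟨start⟩)
  let e₀ : S ≃ Fin (n + 1) := Fintype.equivFinOfCardEq hn
  let e : S ≃ Fin (n + 1) := e₀.trans (Equiv.swap (e₀ start) 0)
  let number : PointedMap Λ (Fin (n + 1)) :=
    ⟨fun q => if h : q ∈ S then e ⟨q, h⟩ else 0, by
      rw [dif_pos (show (default : Λ) ∈ S from hS.1)]
      exact Equiv.swap_apply_left _ _⟩
  let state : Fin (n + 1) → Λ := fun i => (e.symm i : Λ)
  have state_number : ∀ q ∈ (S : Set Λ), state (number q) = q := fun q hq => by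
    have : number q = e ⟨q, hq⟩ := dif_pos (show q ∈ S from hq)
    simp [state, this]
  let symbols : PointedMap Γ Γ := ⟨id, rfl⟩
  refine ⟨n, TM0.Machine.map M symbols symbols number state, fun l => ?_⟩
  have respects := TM0.Machine.map_respects M symbols symbols number state hS (fun _ => rfl)
    state_number
  have init_eq := TM0.map_init symbols number l
  rw [show l.map symbols = l from List.map_id l] at init_eq
  exact tr_eval_dom respects (a₁ := TM0.init l) ⟨hS.1, init_eq⟩

theorem trTape_mk₁ {Γ : Type*} [Inhabited Γ] {n : ℕ} {enc : Γ → List.Vector Bool n}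
    (enc0 : enc default = List.Vector.replicate n false) (l : List Γ) :
    TM1to1.trTape enc0 (Tape.mk₁ l) = Tape.mk₁ (l.flatMap fun a => (enc a).toList) := by
  rw [Tape.mk₁, Tape.mk₂, TM1to1.trTape_mk', TM1to1.trTape', Tape.mk₁, Tape.mk₂,
    ListBlank.flatMap_mk, ListBlank.flatMap_mk]
  rfl

theorem exists_bool_machine {Γ Λ σ : Type*} [Inhabited Γ] [Finite Γ] [Inhabited Λ]
    [Inhabited σ] [Finite σ] (M : Λ → TM1.Stmt Γ Λ σ) (S : Finset Λ) (hS : TM1.Supports M S) :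
    ∃ (n : ℕ) (M' : TM0.Machine Bool (Fin (n + 1))) (w : Γ → List Bool),
      ∀ l, (TM0.eval M' (l.flatMap w)).Dom ↔ (TM1.eval M l).Dom := by
  classical
  let := Fintype.ofFinite Γ
  let := Fintype.ofFinite σ
  obtain ⟨n, enc, dec, enc0, encdec⟩ := TM1to1.exists_enc_dec (Γ := Γ)
  have hM₁ := TM1to1.tr_supports enc dec M hS
  obtain ⟨k, M', hM'⟩ := exists_fin_machine _ _ (TM1to0.tr_supports (TM1to1.tr enc dec M) hM₁)
  refine ⟨k, M', fun a => (enc a).toList, fun l => ?_⟩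
  have init_eq : TM1to1.trCfg enc enc0 (TM1.init l : TM1.Cfg Γ Λ σ) =
      TM1.init (l.flatMap fun a => (enc a).toList) := by
    simp only [TM1to1.trCfg, TM1.init, trTape_mk₁ enc0]
    rfl
  rw [hM', TM1to0.tr_eval]
  exact tr_eval_dom (TM1to1.tr_respects dec M encdec) init_eq

/-- The symbol for a binary digit in Mathlib's compilation of partial recursive functions to a
multi-stack machine. -/
def digitSymbol (b : Bool) : PartrecToTM2.Γ' := cond b .bit1 .bit0

theorem trPosNum_eq_map_bits (p : PosNum) :
    PartrecToTM2.trPosNum p = (p : ℕ).bits.map digitSymbol := by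
  induction p with
  | one => simp [PartrecToTM2.trPosNum, Nat.one_bits, digitSymbol]
  | bit0 p ih =>
    rw [PartrecToTM2.trPosNum, PosNum.cast_bit0, ← two_mul,
      Nat.bit0_bits _ (PosNum.to_nat_pos p).ne', ih]
    rfl
  | bit1 p ih =>
    rw [PartrecToTM2.trPosNum, PosNum.cast_bit1, ← two_mul, Nat.bit1_bits, ih]
    rfl

theorem trNat_eq_map_bits (n : ℕ) : PartrecToTM2.trNat n = n.bits.map digitSymbol := by
  rw [PartrecToTM2.trNat]
  conv_rhs => rw [← Num.to_of_nat n]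
  cases (n : Num) with
  | zero => simp [PartrecToTM2.trNum]
  | pos p => exact trPosNum_eq_map_bits p

/-- The symbol of the one-tape simulation of the multi-stack machine that shows `a` on the main
stack and nothing on the others; the flag marks the bottom of the stacks. -/
def stackSymbol (bottom : Bool) (a : PartrecToTM2.Γ') :
    TM2to1.Γ' PartrecToTM2.K' fun _ => PartrecToTM2.Γ' :=
  (bottom, Function.update (fun _ => none) .main (some a))

theorem trInit_trList_singleton (m : ℕ) :
    TM2to1.trInit PartrecToTM2.K'.main (PartrecToTM2.trList [m]) =
      stackSymbol true .cons :: m.bits.reverse.map fun b => stackSymbol false (digitSymbol b) := by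
  have reverse_eq : (PartrecToTM2.trList [m]).reverse =
      .cons :: m.bits.reverse.map digitSymbol := by
    simp [trNat_eq_map_bits]
  unfold TM2to1.trInit
  rw [reverse_eq]
  exact congrArg (List.cons _) (List.map_map ..)

theorem eval_tr_dom (c : ToPartrec.Code) (v : List ℕ) :
    letI : Inhabited PartrecToTM2.Λ' := ⟨PartrecToTM2.trNormal c .halt⟩
    (TM2.eval PartrecToTM2.tr .main (PartrecToTM2.trList v)).Dom ↔ (c.eval v).Dom := by
  let : Inhabited PartrecToTM2.Λ' := ⟨PartrecToTM2.trNormal c .halt⟩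
  have init_eq : (TM2.init PartrecToTM2.K'.main (PartrecToTM2.trList v) :
      TM2.Cfg (fun _ : PartrecToTM2.K' => PartrecToTM2.Γ') PartrecToTM2.Λ'
        (Option PartrecToTM2.Γ')) = PartrecToTM2.init c v := by
    simp only [TM2.init, PartrecToTM2.init]
    congr 1
    funext k
    cases k <;> rfl
  change (StateTransition.eval (TM2.step PartrecToTM2.tr) (TM2.init _ _)).Dom ↔ _
  rw [init_eq, PartrecToTM2.tr_eval]
  rfl

instance : Fintype PartrecToTM2.K' :=
  ⟨{.main, .rev, .aux, .stack}, fun k => by cases k <;> decide⟩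

theorem exists_bool_machine_of_partrec {f : ℕ →. ℕ} (hf : Partrec f) :
    ∃ (n : ℕ) (M : TM0.Machine Bool (Fin (n + 1))) (v : List Bool) (w : Bool → List Bool),
      ∀ m, (TM0.eval M (v ++ m.bits.reverse.flatMap w)).Dom ↔ (f m).Dom := by
  obtain ⟨c, hc⟩ := ToPartrec.Code.exists_code (Nat.Partrec'.part_iff₁.2 hf)
  let : Inhabited PartrecToTM2.Λ' := ⟨PartrecToTM2.trNormal c .halt⟩
  have supports := TM2to1.tr_supports PartrecToTM2.tr (PartrecToTM2.tr_supports c .halt)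
  obtain ⟨n, M, w, hM⟩ := exists_bool_machine _ _ supports
  refine ⟨n, M, w (stackSymbol true .cons), fun b => w (stackSymbol false (digitSymbol b)),
    fun m => ?_⟩
  have code_dom : (c.eval [m]).Dom ↔ (f m).Dom := by
    rw [show c.eval [m] = _ from hc ⟨[m], rfl⟩]
    rfl
  have machine_dom := hM (TM2to1.trInit .main (PartrecToTM2.trList [m]))
  rw [trInit_trList_singleton, List.flatMap_cons, List.flatMap_map, ← trInit_trList_singleton]
    at machine_dom
  exact machine_dom.trans ((TM2to1.tr_eval_dom _ _ _).trans ((eval_tr_dom c [m]).trans code_dom))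

theorem bits_eq_bodd_cons {n : ℕ} (hn : n ≠ 0) : n.bits = n.bodd :: (n / 2).bits := by
  conv_lhs => rw [← Nat.bit_bodd_div2 n]
  rw [Nat.bits_append_bit, Nat.div2_val]
  intro h
  have := Nat.bodd_add_div2 n
  cases hb : n.bodd <;> simp_all

theorem primrec_bits : Primrec Nat.bits := by
  have recursion : Primrec fun H : List (List Bool) =>
      if H.length = 0 then some []
      else (H[H.length / 2]?).map fun l => Nat.bodd H.length :: l :=
    .ite (Primrec.eq.comp .list_length (.const 0)) (.const _)
      (.option_map (Primrec.list_getElem?.comp .id (Primrec.nat_div.comp .list_length (.const 2)))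
        (Primrec.list_cons.comp (Primrec.nat_bodd.comp (Primrec.list_length.comp .fst)) .snd))
  have h := Primrec.nat_strong_rec (fun (_ : Unit) n => Nat.bits n) (recursion.comp .snd).to₂
    fun _ n => by
      rcases eq_or_ne n 0 with rfl | hn
      · simp
      · simp [hn, bits_eq_bodd_cons hn, Nat.div_lt_self (Nat.pos_of_ne_zero hn) one_lt_two]
  exact h.comp (.const ()) .id

theorem exists_universal_bool_machine :
    ∃ (n : ℕ) (M : TM0.Machine Bool (Fin (n + 1))) (input : Nat.Partrec.Code → ℕ → List Bool),
      Computable₂ input ∧ ∀ c m, (TM0.eval M (input c m)).Dom ↔ (c.eval m).Dom := by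
  let universal : ℕ →. ℕ := fun p =>
    ((Encodable.decode p.unpair.1 : Option Nat.Partrec.Code).getD .zero).eval p.unpair.2
  have partrec_universal : Partrec universal :=
    Nat.Partrec.Code.eval_part.comp
      (.option_getD (Computable.decode.comp (Primrec.fst.comp Primrec.unpair).to_comp) (.const _))
      (Primrec.snd.comp Primrec.unpair).to_comp
  obtain ⟨n, M, v, w, hM⟩ := exists_bool_machine_of_partrec partrec_universal
  refine ⟨n, M, fun c m => v ++ (Nat.pair (Encodable.encode c) m).bits.reverse.flatMap w, ?_,
    fun c m => ?_⟩
  · have primrec_pair :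
        Primrec fun p : Nat.Partrec.Code × ℕ => Nat.pair (Encodable.encode p.1) p.2 :=
      Primrec₂.natPair.comp (Primrec.encode.comp .fst) .snd
    exact (Primrec.list_append.comp (.const v) (.list_flatMap
      (Primrec.list_reverse.comp (primrec_bits.comp primrec_pair))
      ((Primrec.dom_finite w).comp .snd).to₂)).to_comp
  · rw [hM]
    simp [universal]

end Machines

section ListsAndTapes

open Turing

theorem lookup_filterMap_map {α κ β : Type*} [BEq β] [LawfulBEq β] {key : κ → β}
    (hkey : Function.Injective key) (value : κ → Option α) {ks : List κ} {k : κ} (hk : k ∈ ks) :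
    (ks.filterMap fun k => (value k).map (Prod.mk (key k))).lookup (key k) = value k := by
  classical
  suffices ∀ ks : List κ,
      (ks.filterMap fun k => (value k).map (Prod.mk (key k))).lookup (key k) =
        if k ∈ ks then value k else none by rw [this, if_pos hk]
  intro ks
  induction ks with
  | nil => simp
  | cons k' ks ih =>
    rw [List.filterMap_cons]
    by_cases h : k = k'
    · subst h
      cases hv : value k <;> simp [ih, hv]
    · have hne : (key k == key k') = false := beq_eq_false_iff_ne.2 (hkey.ne h)
      cases hv : value k' <;> simp [ih, h, List.lookup_cons, hne]

theorem lookup_map_range {β γ : Type*} [BEq β] [LawfulBEq β] {key : ℕ → β}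
    (hkey : Function.Injective key) (value : ℕ → γ) (n i : ℕ) :
    ((List.range n).map fun i => (key i, value i)).lookup (key i) =
      if i < n then some (value i) else none := by
  split_ifs with hi
  · simpa [List.filterMap_eq_map'] using
      lookup_filterMap_map hkey (fun i => some (value i)) (List.mem_range.2 hi)
  · rw [List.lookup_eq_none_iff]
    intro p hp
    obtain ⟨j, hj, rfl⟩ := List.mem_map.1 hp
    exact bne_iff_ne.2 (hkey.ne (by rintro rfl; exact hi (List.mem_range.1 hj)))

theorem lookup_map_range_of_ne {β γ : Type*} [BEq β] [LawfulBEq β] {key : ℕ → β} {b : β}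
    (h : ∀ i, key i ≠ b) (value : ℕ → γ) (n : ℕ) :
    ((List.range n).map fun i => (key i, value i)).lookup b = none := by
  simpa [List.lookup_eq_none_iff] using fun i _ => (h i).symm

theorem countP_range_lt {k n : ℕ} (hk : k ≤ n) : (List.range n).countP (· < k) = k := by
  obtain ⟨m, rfl⟩ := Nat.exists_eq_add_of_le hk
  rw [List.range_add, List.countP_append, List.countP_eq_length.2 (by simp),
    List.countP_eq_zero.2 (by simp), List.length_range, add_zero]

theorem nth_mk₁_natCast {Γ : Type*} [Inhabited Γ] (l : List Γ) (n : ℕ) :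
    (Tape.mk₁ l).nth n = l.getI n := by
  rw [Tape.mk₁, Tape.mk₂, Tape.mk'_nth_nat, ListBlank.nth_mk]

theorem nth_mk₁_of_neg {Γ : Type*} [Inhabited Γ] (l : List Γ) {x : ℤ} (hx : x < 0) :
    (Tape.mk₁ l).nth x = default := by
  obtain ⟨n, rfl⟩ := Int.eq_negSucc_of_lt_zero hx
  change (ListBlank.mk ([] : List Γ)).nth n = default
  rw [ListBlank.nth_mk]
  rfl

theorem primrec_intCast : Primrec (Nat.cast : ℕ → ℤ) :=
  Primrec.encode_iff.1 <| (Primrec.nat_mul.comp (.const 2) .id).of_eq fun _ => rfl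

end ListsAndTapes

namespace CivGame

section Play

variable {State Order Obs : Type} {G : CivGame State Order Obs}

/-- Carrying out the orders `os` on consecutive turns, all of them permitted, leads from `s` to
`s'`. -/
def Run (G : CivGame State Order Obs) (os : List Order) (s s' : State) : Prop :=
  os.foldlM G.turn s = some s'

theorem Run.nil (s : State) : G.Run [] s s := rfl

theorem Run.single {o : Order} {s s' : State} (h : G.turn s o = some s') : G.Run [o] s s' := by
  simp [Run, h]

theorem Run.append {os os' : List Order} {s s' s'' : State} (h : G.Run os s s')
    (h' : G.Run os' s' s'') : G.Run (os ++ os') s s'' := by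
  unfold Run at *
  rw [List.foldlM_append, h]
  exact h'

variable [DecidableEq Obs] {T : CommandTable Obs Order}

theorem Run.round {os : List Order} {s s' : State} (h : G.Run os s s')
    (hT : T.lookup (G.observe s) = some os) : G.Round T s s' := ⟨os, hT, h⟩

/-- One round of play under the table `T` as a partial function, `none` standing for `HALT`. A
command that is not permitted leaves the state unchanged, so that the iteration does not
terminate. -/
def roundStep (G : CivGame State Order Obs) (T : CommandTable Obs Order) (s : State) :
    Option State :=
  (T.lookup (G.observe s)).map fun os => (os.foldlM G.turn s).getD s

theorem Round.mem_roundStep {s s' : State} (h : G.Round T s s') : s' ∈ G.roundStep T s := by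
  obtain ⟨os, lookup_eq, run⟩ := h
  simp [roundStep, lookup_eq, run]

theorem reflTransGen_round_of_mem_roundStep {s s' : State} (h : s' ∈ G.roundStep T s) :
    Relation.ReflTransGen (G.Round T) s s' := by
  obtain ⟨os, lookup_eq, rfl⟩ := Option.map_eq_some_iff.1 h
  cases run : os.foldlM G.turn s with
  | none => exact .refl
  | some s' => exact .single ⟨os, lookup_eq, run⟩

theorem halts_iff_eval_roundStep_dom {s : State} :
    G.Halts T s ↔ (StateTransition.eval (G.roundStep T) s).Dom := by
  simp only [Part.dom_iff_mem, StateTransition.mem_eval, Halts]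
  refine exists_congr fun s' => and_congr ⟨fun h => ?_, fun h => ?_⟩ (by simp [roundStep])
  · exact Relation.ReflTransGen.mono (fun _ _ => Round.mem_roundStep) _ _ h
  · exact Relation.ReflTransGen.trans_induction_on h (fun _ => .refl)
      reflTransGen_round_of_mem_roundStep fun _ _ => .trans

theorem halts_iff_of_simulation {σ : Type*} {f : σ → Option σ} {R : σ → State → Prop}
    (hstep : ∀ {c c' s}, f c = some c' → R c s →
      ∃ s', Relation.TransGen (G.Round T) s s' ∧ R c' s')
    (hhalt : ∀ {c s}, f c = none → R c s → T.lookup (G.observe s) = none)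
    {c : σ} {s : State} (h : R c s) : G.Halts T s ↔ (StateTransition.eval f c).Dom := by
  rw [halts_iff_eval_roundStep_dom]
  refine StateTransition.tr_eval_dom (tr := R) (fun c s hR => ?_) h
  cases hf : f c with
  | none => simp [roundStep, hhalt hf hR]
  | some c' =>
    obtain ⟨s', reach, hR'⟩ := hstep hf hR
    exact ⟨s', hR', Relation.TransGen.mono (fun _ _ => Round.mem_roundStep) _ _ reach⟩

/-- The table that assigns to each observation `obs k` the command `cmd k`. -/
noncomputable def mkTable {κ : Type} [Fintype κ] (obs : κ → Obs)
    (cmd : κ → Option (List Order)) : CommandTable Obs Order :=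
  Finset.univ.toList.filterMap fun k => (cmd k).map (Prod.mk (obs k))

theorem lookup_mkTable {κ : Type} [Fintype κ] {obs : κ → Obs} (hobs : Function.Injective obs)
    (cmd : κ → Option (List Order)) (k : κ) : (mkTable obs cmd).lookup (obs k) = cmd k :=
  lookup_filterMap_map hobs cmd (by simp)

theorem SimulatesUniversal.undecidableUnder [Primcodable State] (h : G.SimulatesUniversal T) :
    G.UndecidableUnder T := by
  obtain ⟨enc, computable_enc, henc⟩ := h
  rintro ⟨decide, computable_decide, hdecide⟩
  refine ComputablePred.halting_problem 0 (ComputablePred.computable_iff.2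
    ⟨fun c => decide (enc c 0), computable_decide.comp (computable_enc.comp .id (.const 0)), ?_⟩)
  funext c
  exact propext ((henc c 0).2.symm.trans (hdecide _ (henc c 0).1).symm)

theorem exists_simulatesUniversal [Primcodable State]
    (h : ∀ (n : ℕ) (M : Turing.TM0.Machine Bool (Fin (n + 1))),
      ∃ (T : CommandTable Obs Order) (init : List Bool → State), Computable init ∧
        ∀ l, G.Valid (init l) ∧ (G.Halts T (init l) ↔ (Turing.TM0.eval M l).Dom)) :
    ∃ T : CommandTable Obs Order, G.SimulatesUniversal T ∧ G.UndecidableUnder T := by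
  obtain ⟨n, M, input, computable_input, hM⟩ := exists_universal_bool_machine
  obtain ⟨T, init, computable_init, hT⟩ := h n M
  have simulates : G.SimulatesUniversal T :=
    ⟨fun c m => init (input c m), computable_init.comp computable_input, fun c m =>
      ⟨(hT _).1, (hT _).2.trans (hM c m)⟩⟩
  exact ⟨T, simulates, simulates.undecidableUnder⟩

end Play

section CounterAndTape

open Turing

variable {State Order Obs : Type} {G : CivGame State Order Obs} {n : ℕ}

/-- A way to operate, by orders in a game, a counter with values up to `n` and a tape over two
symbols: `Represents k T s` says that the state `s` shows the value `k` and the tape `T`. -/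
structure TapeInterface (G : CivGame State Order Obs) (n : ℕ) where
  Represents : ℕ → Tape Bool → State → Prop
  obs : ℕ × Bool → Obs
  obs_injective : Function.Injective obs
  inc : List Order
  dec : List Order
  move : Dir → List Order
  write : Bool → List Order
  observe_eq : ∀ {k T s}, Represents k T s → G.observe s = obs (k, T.head)
  run_inc : ∀ {k T s}, Represents k T s → k < n → ∃ s', G.Run inc s s' ∧ Represents (k + 1) T s'
  run_dec : ∀ {k T s}, Represents (k + 1) T s → ∃ s', G.Run dec s s' ∧ Represents k T s'
  run_move : ∀ {k T s} (d : Dir), Represents k T s →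
    ∃ s', G.Run (move d) s s' ∧ Represents k (T.move d) s'
  run_write : ∀ {k T s} (a : Bool), Represents k T s → T.head ≠ a →
    ∃ s', G.Run (write a) s s' ∧ Represents k (T.write a) s'

namespace TapeInterface

variable (I : TapeInterface G n) {k k' : ℕ} {T : Tape Bool} {s : State}

theorem run_replicate_dec (h : I.Represents k T s) :
    ∃ s', G.Run (List.replicate k I.dec).flatten s s' ∧ I.Represents 0 T s' := by
  induction k generalizing s with
  | zero => exact ⟨s, .nil s, h⟩
  | succ k ih =>
    obtain ⟨s₁, run_dec, h₁⟩ := I.run_dec h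
    obtain ⟨s₂, run_decs, h₂⟩ := ih h₁
    rw [List.replicate_succ, List.flatten_cons]
    exact ⟨s₂, run_dec.append run_decs, h₂⟩

theorem run_replicate_inc (h : I.Represents 0 T s) (hk : k ≤ n) :
    ∃ s', G.Run (List.replicate k I.inc).flatten s s' ∧ I.Represents k T s' := by
  induction k with
  | zero => exact ⟨s, .nil s, h⟩
  | succ k ih =>
    obtain ⟨s₁, run_incs, h₁⟩ := ih (Nat.le_of_succ_le hk)
    obtain ⟨s₂, run_inc, h₂⟩ := I.run_inc h₁ hk
    rw [List.replicate_succ', List.flatten_append, List.flatten_singleton]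
    exact ⟨s₂, run_incs.append run_inc, h₂⟩

/-- Orders that change the value of the counter from `k` to `k'`. -/
def setCounter (k k' : ℕ) : List Order :=
  (List.replicate k I.dec).flatten ++ (List.replicate k' I.inc).flatten

theorem run_setCounter (h : I.Represents k T s) (hk : k' ≤ n) :
    ∃ s', G.Run (I.setCounter k k') s s' ∧ I.Represents k' T s' := by
  obtain ⟨s₁, run_decs, h₁⟩ := I.run_replicate_dec h
  obtain ⟨s₂, run_incs, h₂⟩ := I.run_replicate_inc h₁ hk
  exact ⟨s₂, run_decs.append run_incs, h₂⟩

/-- Orders that carry out an action of a Turing machine that reads `b`. -/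
def act (b : Bool) : TM0.Stmt Bool → List Order
  | .move d => I.move d
  | .write a => if b = a then [] else I.write a

theorem run_act (h : I.Represents k T s) (a : TM0.Stmt Bool) :
    ∃ s', G.Run (I.act T.head a) s s' ∧ I.Represents k (match a with
      | .move d => T.move d
      | .write a => T.write a) s' := by
  cases a with
  | move d => exact I.run_move d h
  | write a =>
    by_cases ha : T.head = a
    · subst ha
      exact ⟨s, by simp [act, Run.nil], by simpa using h⟩
    · simpa [act, ha] using I.run_write a h ha

/-- The command for a Turing machine in state `k.1` that reads `k.2`. -/
def command (M : TM0.Machine Bool (Fin (n + 1))) (k : Fin (n + 1) × Bool) :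
    Option (List Order) :=
  (M k.1 k.2).map fun x => I.setCounter k.1 x.1 ++ I.act k.2 x.2

variable [DecidableEq Obs]

theorem exists_table (M : TM0.Machine Bool (Fin (n + 1))) : ∃ T : CommandTable Obs Order,
    ∀ {l s}, I.Represents 0 (Tape.mk₁ l) s → (G.Halts T s ↔ (TM0.eval M l).Dom) := by
  let obs : Fin (n + 1) × Bool → Obs := fun k => I.obs (k.1, k.2)
  have obs_injective : Function.Injective obs :=
    I.obs_injective.comp (Function.Injective.prodMap Fin.val_injective Function.injective_id)
  have lookup_eq {q T s} (h : I.Represents (q : Fin (n + 1)) T s) :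
      (mkTable obs (I.command M)).lookup (G.observe s) = I.command M (q, T.head) := by
    rw [I.observe_eq h]
    exact lookup_mkTable obs_injective _ (q, T.head)
  refine ⟨mkTable obs (I.command M), fun {l s} h => halts_iff_of_simulation (f := TM0.step M)
    (R := fun c s => I.Represents c.q c.Tape s) ?_ ?_ (c := TM0.init l) h⟩
  · rintro ⟨q, T⟩ c' s hstep hR
    obtain ⟨⟨q', a⟩, hM, rfl⟩ := Option.map_eq_some_iff.1 hstep
    obtain ⟨s₁, run_setCounter, h₁⟩ := I.run_setCounter hR (Nat.lt_succ_iff.1 q'.2)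
    obtain ⟨s₂, run_act, h₂⟩ := I.run_act h₁ a
    refine ⟨s₂, .single ((run_setCounter.append run_act).round ?_), by cases a <;> exact h₂⟩
    simp [lookup_eq hR, command, hM]
  · rintro ⟨q, T⟩ s hstep hR
    rw [lookup_eq hR, command, Option.map_eq_none_iff.1 hstep, Option.map_none]

theorem exists_simulatesUniversal [Primcodable State]
    (h : ∀ n : ℕ, ∃ (I : TapeInterface G n) (init : List Bool → State), Computable init ∧
      ∀ l, G.Valid (init l) ∧ I.Represents 0 (Tape.mk₁ l) (init l)) :
    ∃ T : CommandTable Obs Order, G.SimulatesUniversal T ∧ G.UndecidableUnder T := by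
  refine CivGame.exists_simulatesUniversal fun n M => ?_
  obtain ⟨I, init, computable_init, hI⟩ := h n
  obtain ⟨T, hT⟩ := I.exists_table M
  exact ⟨T, init, computable_init, fun l => ⟨(hI l).1, hT (hI l).2⟩⟩

end TapeInterface

end CounterAndTape

section Workers

open Turing

/-- The two rows of the map that are in use: the improvements in row `1` encode the counter in
unary, those in row `0` the tape. Each row has its own Worker and its own kind of improvement. -/
inductive Row
  | counter | tape
  deriving DecidableEq

variable {State Order Obs : Type} {G : CivGame State Order Obs} {n : ℕ}

theorem run_build {Project : Type} [DecidableEq Project] {o : Order}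
    {before after : Worker Project → State} {p : Project} {cost : ℕ} {h : Hex}
    (hturn : ∀ job, G.turn (before ⟨h, job⟩) o =
      let x := Worker.work ⟨h, job⟩ p cost
      some (if x.2 then after x.1 else before x.1)) :
    G.Run (List.replicate (max cost 1) o) (before ⟨h, none⟩) (after ⟨h, none⟩) := by
  have run_remaining : ∀ m spent job, (job = none ∧ spent = 0) ∨ job = some (p, spent) →
      spent + m + 1 = max cost 1 →
      G.Run (List.replicate (m + 1) o) (before ⟨h, job⟩) (after ⟨h, none⟩) := by
    intro m
    induction m with
    | zero =>
      intro spent job hjob hspent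
      have done : cost ≤ spent + 1 := by omega
      apply Run.single
      rcases hjob with ⟨rfl, rfl⟩ | rfl <;> simp [hturn, Worker.work, done]
    | succ m ih =>
      intro spent job hjob hspent
      have not_done : ¬ cost ≤ spent + 1 := by omega
      have turn_eq : G.turn (before ⟨h, job⟩) o = some (before ⟨h, some (p, spent + 1)⟩) := by
        rcases hjob with ⟨rfl, rfl⟩ | rfl <;> simp [hturn, Worker.work, not_done]
      exact (Run.single turn_eq).append (ih (spent + 1) _ (.inr rfl) (by omega))
  obtain ⟨m, hm⟩ := Nat.exists_eq_succ_of_ne_zero (show max cost 1 ≠ 0 by omega)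
  rw [hm]
  exact run_remaining m 0 none (.inl ⟨rfl, rfl⟩) (by omega)

/-- The tiles on which the value of the counter is recorded. -/
def counterTiles (n : ℕ) : List Hex := (List.range n).map fun j : ℕ => ((j : ℤ), (1 : ℤ))

theorem mem_counterTiles {n j : ℕ} (h : j < n) : ((j : ℤ), (1 : ℤ)) ∈ counterTiles n :=
  List.mem_map.2 ⟨j, List.mem_range.2 h, rfl⟩

theorem nodup_counterTiles (n : ℕ) : (counterTiles n).Nodup :=
  List.nodup_range.map fun i j h => by simpa using h

/-- The improvement on a tile of the tape on which the symbol `b` is written. -/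
def tapeCell (b : Bool) : Option Row := if b then some .tape else none

/-- The improvements on the map when the counter has the value `k` and the tape Worker, at the head
of the tape `T`, is on the tile `(p, 0)`. -/
def board (k : ℕ) (T : Tape Bool) (p : ℤ) (h : Hex) : Option Row :=
  if h.2 = 1 ∧ 0 ≤ h.1 ∧ h.1 < k then some .counter
  else if h.2 = 0 then tapeCell (T.nth (h.1 - p)) else none

/-- The positions of the Workers: the counter Worker is on the first blank tile of its row. -/
def positions (k : ℕ) (p : ℤ) : Row → Hex
  | .counter => (k, 1)
  | .tape => (p, 0)

/-- The direction on the map that corresponds to a direction on the tape. -/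
def hexDir : Dir → HexDir
  | .left => .west
  | .right => .east

/-- The step on the tape in a direction. -/
def step : Dir → ℤ
  | .left => -1
  | .right => 1

theorem hexDir_vec (d : Dir) : (hexDir d).vec = (step d, 0) := by cases d <;> rfl

theorem nth_move (T : Tape Bool) (d : Dir) (x : ℤ) : (T.move d).nth x = T.nth (x + step d) := by
  cases d
  · exact Tape.move_left_nth T x
  · exact Tape.move_right_nth T x

variable (k : ℕ) (T : Tape Bool) (p : ℤ)

theorem board_counter_self : board k T p (k, 1) = none := by simp [board]

theorem board_tape_self : board k T p (p, 0) = tapeCell T.head := by simp [board]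

theorem update_board_succ :
    Function.update (board k T p) (k, 1) (some .counter) = board (k + 1) T p := by
  funext ⟨x, y⟩
  simp only [Function.update_apply, board, Prod.mk.injEq, Nat.cast_add, Nat.cast_one]
  grind

theorem update_board_pred :
    Function.update (board (k + 1) T p) (k, 1) none = board k T p := by
  rw [← update_board_succ, Function.update_idem, Function.update_eq_self_iff, board_counter_self]

theorem update_board_write (a : Bool) :
    Function.update (board k T p) (p, 0) (tapeCell a) = board k (T.write a) p := by
  funext ⟨x, y⟩
  simp only [Function.update_apply, board, Prod.mk.injEq, Tape.write_nth]
  grind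

theorem board_move (d : Dir) : board k (T.move d) (p + step d) = board k T p := by
  funext h
  simp only [board, nth_move, sub_add_eq_sub_sub, sub_add_cancel]

theorem countP_board {k : ℕ} (hk : k ≤ n) :
    (counterTiles n).countP (fun h => board k T p h = some .counter) = k := by
  have board_eq (j : ℕ) : board k T p (j, 1) = some .counter ↔ j < k := by simp [board]
  simpa only [counterTiles, List.countP_map, Function.comp_def, board_eq] using countP_range_lt hk

/-- A way to operate two Workers by orders in a game. `Shows f w s` says that in the state `s` the
improvements on the map are given by `f` and the Workers are idle on the tiles `w`; improvements
of the kind `counter` can be built only on `counterTiles n`, and there their number is observed. -/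
structure WorkerInterface (G : CivGame State Order Obs) (n : ℕ) where
  Shows : (Hex → Option Row) → (Row → Hex) → State → Prop
  obs : ℕ × Option Row → Obs
  obs_injective : Function.Injective obs
  move : Row → HexDir → List Order
  build : Row → List Order
  remove : Row → List Order
  observe_eq : ∀ {f w s}, Shows f w s →
    G.observe s = obs ((counterTiles n).countP (fun h => f h = some .counter), f (w .tape))
  run_move : ∀ {f w s} (ρ : Row) (d : HexDir), Shows f w s →
    ∃ s', G.Run (move ρ d) s s' ∧ Shows f (Function.update w ρ (w ρ + d.vec)) s'
  run_build : ∀ {f w s} (ρ : Row), Shows f w s → f (w ρ) = none →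
    (ρ = .counter → w ρ ∈ counterTiles n) →
    ∃ s', G.Run (build ρ) s s' ∧ Shows (Function.update f (w ρ) (some ρ)) w s'
  run_remove : ∀ {f w s} (ρ : Row), Shows f w s → f (w ρ) ≠ none →
    ∃ s', G.Run (remove ρ) s s' ∧ Shows (Function.update f (w ρ) none) w s'

namespace WorkerInterface

variable (W : WorkerInterface G n) {k T} {s : State}

/-- The state `s` shows the value `k` of the counter and the tape `T`. -/
def Represents (k : ℕ) (T : Tape Bool) (s : State) : Prop :=
  k ≤ n ∧ ∃ p, W.Shows (board k T p) (positions k p) s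

theorem run_inc (h : W.Represents k T s) (hk : k < n) :
    ∃ s', G.Run (W.build .counter ++ W.move .counter .east) s s' ∧
      W.Represents (k + 1) T s' := by
  obtain ⟨-, p, h⟩ := h
  obtain ⟨s₁, run_build, h₁⟩ :=
    W.run_build .counter h (board_counter_self k T p) fun _ => mem_counterTiles hk
  obtain ⟨s₂, run_move, h₂⟩ := W.run_move .counter .east h₁
  refine ⟨s₂, run_build.append run_move, hk, p, ?_⟩
  convert h₂ using 1
  · exact (update_board_succ k T p).symm
  · funext ρ
    cases ρ <;> simp [positions, HexDir.vec]

theorem run_dec (h : W.Represents (k + 1) T s) :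
    ∃ s', G.Run (W.move .counter .west ++ W.remove .counter) s s' ∧ W.Represents k T s' := by
  obtain ⟨hk, p, h⟩ := h
  obtain ⟨s₁, run_move, h₁⟩ := W.run_move .counter .west h
  have positions_eq : Function.update (positions (k + 1) p) .counter
      (positions (k + 1) p .counter + HexDir.west.vec) = positions k p := by
    funext ρ
    cases ρ <;> simp [positions, HexDir.vec]
  rw [positions_eq] at h₁
  obtain ⟨s₂, run_remove, h₂⟩ := W.run_remove .counter h₁ (by simp [positions, board])
  refine ⟨s₂, run_move.append run_remove, Nat.le_of_succ_le hk, p, ?_⟩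
  exact update_board_pred k T p ▸ h₂

theorem run_moveTape (d : Dir) (h : W.Represents k T s) :
    ∃ s', G.Run (W.move .tape (hexDir d)) s s' ∧ W.Represents k (T.move d) s' := by
  obtain ⟨hk, p, h⟩ := h
  obtain ⟨s₁, run_move, h₁⟩ := W.run_move .tape (hexDir d) h
  refine ⟨s₁, run_move, hk, p + step d, ?_⟩
  rw [board_move]
  convert h₁ using 1
  funext ρ
  cases ρ <;> simp [positions, hexDir_vec]

theorem run_write (a : Bool) (h : W.Represents k T s) (ha : T.head ≠ a) :
    ∃ s', G.Run (cond a (W.build .tape) (W.remove .tape)) s s' ∧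
      W.Represents k (T.write a) s' := by
  obtain ⟨hk, p, h⟩ := h
  have head_eq := board_tape_self k T p
  suffices ∃ s', G.Run (cond a (W.build .tape) (W.remove .tape)) s s' ∧
      W.Shows (Function.update (board k T p) (p, 0) (tapeCell a)) (positions k p) s' by
    obtain ⟨s', run, h'⟩ := this
    exact ⟨s', run, hk, p, by rwa [update_board_write] at h'⟩
  cases a with
  | true =>
    refine W.run_build .tape h (head_eq.trans ?_) (by simp)
    simp [tapeCell, ha]
  | false =>
    refine W.run_remove .tape h (head_eq.trans_ne ?_)
    simp [tapeCell, Bool.eq_true_of_not_eq_false ha]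

/-- Two Workers operate a counter and a tape. -/
def tapeInterface : TapeInterface G n where
  Represents := W.Represents
  obs x := W.obs (x.1, tapeCell x.2)
  obs_injective := W.obs_injective.comp <| Function.injective_id.prodMap (by decide)
  inc := W.build .counter ++ W.move .counter .east
  dec := W.move .counter .west ++ W.remove .counter
  move d := W.move .tape (hexDir d)
  write a := cond a (W.build .tape) (W.remove .tape)
  observe_eq := by
    rintro k T s ⟨hk, p, h⟩
    rw [W.observe_eq h, countP_board _ _ hk, ← board_tape_self k T p]
    rfl
  run_inc := W.run_inc
  run_dec := W.run_dec
  run_move := W.run_moveTape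
  run_write := W.run_write

end WorkerInterface

/-- A list of improvements that writes the word `l` on the tape, in a game in which the content `c`
of a tile is represented by the improvement `improvement c`. -/
def tapeImprovements {Improvement : Type} (improvement : Option Row → Improvement)
    (l : List Bool) : List (Hex × Improvement) :=
  (List.range l.length).map fun i : ℕ => (((i : ℤ), (0 : ℤ)), improvement (tapeCell (l.getI i)))

theorem lookup_tapeImprovements {Improvement : Type} (improvement : Option Row → Improvement)
    (l : List Bool) (h : Hex) :
    ((tapeImprovements improvement l).lookup h).getD (improvement none) =
      improvement (board 0 (Tape.mk₁ l) 0 h) := by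
  rw [tapeImprovements]
  obtain ⟨x, y⟩ := h
  by_cases hxy : y = 0 ∧ 0 ≤ x
  · obtain ⟨rfl, hx⟩ := hxy
    obtain ⟨i, rfl⟩ := Int.eq_ofNat_of_zero_le hx
    rw [lookup_map_range (key := fun i : ℕ => ((i : ℤ), (0 : ℤ))) fun i j h => by simpa using h]
    split_ifs with hi
    · simp [board, nth_mk₁_natCast]
    · simp [board, nth_mk₁_natCast, tapeCell, List.getI_eq_default _ (not_lt.1 hi)]
  · rw [lookup_map_range_of_ne (key := fun i : ℕ => ((i : ℤ), (0 : ℤ))) (by grind)]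
    rcases lt_or_ge x 0 with hx | hx
    · simp [board, nth_mk₁_of_neg l hx, tapeCell, hx.not_ge]
    · simp [board, show y ≠ 0 by grind, hx.not_gt]

theorem primrec_tapeImprovements {Improvement : Type} [Primcodable Improvement]
    (improvement : Option Row → Improvement) : Primrec (tapeImprovements improvement) :=
  Primrec.list_map (Primrec.list_range.comp .list_length) <|
    (Primrec.pair (primrec_intCast.comp .snd) (.const 0)).pair <|
      (Primrec.dom_finite fun b => improvement (tapeCell b)).comp
        (Primrec.list_getI.comp .fst .snd)

end Workers

end CivGame

namespace CivBE

open CivGame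

/-- The content of a tile in Civ:BE: the counter is built of Terrascapes, the tape of Roads. -/
def improvement : Option Row → Improvement
  | none => .unimproved
  | some .counter => .terrascape
  | some .tape => .road

theorem improvement_injective : Function.Injective improvement := by
  rintro (_ | _ | _) (_ | _ | _) <;> simp [improvement]

theorem improvement_ne_pillagedRoad : ∀ c, improvement c ≠ .pillagedRoad := by
  rintro (_ | _ | _) <;> decide

/-- What the Worker of a row builds. -/
def project : Row → Project
  | .counter => .terrascape
  | .tape => .road

/-- The number of turns that the Worker of a row needs to build. -/
def buildTurns (r : Rules) : Row → ℕ
  | .counter => r.terrascapeTurns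
  | .tape => r.roadTurns

/-- The Worker of a row. -/
def State.worker (s : State) : Row → Worker Project
  | .counter => s.stateWorker
  | .tape => s.tapeWorker

/-- Replace the Worker of a row. -/
def State.setWorker (s : State) (w : Worker Project) : Row → State
  | .counter => { s with stateWorker := w }
  | .tape => { s with tapeWorker := w }

/-- An order only for the Worker of a row. -/
def order (o : WorkerOrder) : Row → Order
  | .counter => ⟨o, .wait, .wait⟩
  | .tape => ⟨.wait, o, .wait⟩

theorem State.improvementAt_setImprovement (s : State) (h : Hex) (i : Improvement) :
    (s.setImprovement h i).improvementAt = Function.update s.improvementAt h i := by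
  funext h'
  by_cases hh : h' = h
  · subst hh
    simp [improvementAt, setImprovement]
  · simp [improvementAt, setImprovement, List.lookup_cons, beq_eq_false_iff_ne.2 hh, hh]

theorem turn_order (r : Rules) (s : State) (o : WorkerOrder) (ρ : Row) :
    turn r s (order o ρ) =
      (workerTurn r s (s.worker ρ) o).map fun x => x.1.setWorker x.2 ρ := by
  cases ρ <;> exact Option.map_eq_bind.symm

theorem workerTurn_build (r : Rules) {s : State} {w : Worker Project} (ρ : Row)
    (blank : s.improvementAt w.pos = .unimproved)
    (permitted : ρ = .counter → w.pos ∈ s.owned ∧ w.pos ∈ s.desert ∧ s.terraforming = true) :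
    workerTurn r s w (.build (project ρ)) =
      let x := w.work (project ρ) (buildTurns r ρ)
      some (if x.2 then s.setImprovement w.pos (improvement (some ρ)) else s, x.1) := by
  cases ρ with
  | counter => exact if_pos ⟨blank, permitted rfl⟩
  | tape => exact if_pos blank

/-- The tiles of the counter are owned desert tiles on which Citizens work, the improvements are
given by `f`, and the Workers are idle on the tiles `w`. -/
structure Shows (n : ℕ) (f : Hex → Option Row) (w : Row → Hex) (s : State) : Prop where
  desert : s.desert = counterTiles n
  owned : s.owned = counterTiles n
  worked : s.worked = counterTiles n
  terraforming : s.terraforming = true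
  ecoscaping : s.ecoscaping = true
  improvementAt : s.improvementAt = improvement ∘ f
  worker : ∀ ρ, s.worker ρ = ⟨w ρ, none⟩

namespace Shows

variable {r : Rules} {n : ℕ} {f : Hex → Option Row} {w : Row → Hex} {s : State}

theorem improvementAt_eq_iff (h : Shows n f w s) {x : Hex} {c : Option Row} :
    s.improvementAt x = improvement c ↔ f x = c := by
  rw [h.improvementAt, Function.comp_apply, improvement_injective.eq_iff]

theorem setWorker (h : Shows n f w s) (ρ : Row) (x : Hex) :
    Shows n f (Function.update w ρ x) (s.setWorker ⟨x, none⟩ ρ) := by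
  obtain ⟨desert, owned, worked, terraforming, ecoscaping, improvementAt, worker⟩ := h
  have := worker .counter
  have := worker .tape
  cases ρ <;> refine ⟨desert, owned, worked, terraforming, ecoscaping, improvementAt, ?_⟩ <;>
    rintro (_ | _) <;> simp_all [State.setWorker, State.worker]

theorem setWorker_self (h : Shows n f w s) (ρ : Row) : s.setWorker ⟨w ρ, none⟩ ρ = s := by
  rw [← h.worker]
  cases ρ <;> rfl

theorem setImprovement (h : Shows n f w s) (x : Hex) (c : Option Row) :
    Shows n (Function.update f x c) w (s.setImprovement x (improvement c)) where
  desert := h.desert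
  owned := h.owned
  worked := h.worked
  terraforming := h.terraforming
  ecoscaping := h.ecoscaping
  improvementAt := by
    rw [State.improvementAt_setImprovement, h.improvementAt, Function.comp_update]
  worker ρ := by
    rw [← h.worker ρ]
    cases ρ <;> rfl

theorem observe_eq (h : Shows n f w s) :
    observe r s = ((r.terrascapeCulture + 1) *
      (counterTiles n).countP (fun x => f x = some .counter), improvement (f (w .tape))) := by
  have terrascape_iff (x : Hex) : s.improvementAt x = .terrascape ↔ f x = some .counter :=
    h.improvementAt_eq_iff (c := some .counter)
  have pos_eq : s.tapeWorker.pos = w .tape := congrArg Worker.pos (h.worker .tape)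
  simp only [observe, State.culture, h.ecoscaping, h.worked, terrascape_iff, pos_eq, if_true,
    Nat.add_sub_cancel_left]
  rw [h.improvementAt, Function.comp_apply]

theorem run_move (h : Shows n f w s) (ρ : Row) (d : HexDir) :
    ∃ s', (game r).Run [order (.move d) ρ] s s' ∧
      Shows n f (Function.update w ρ (w ρ + d.vec)) s' := by
  refine ⟨_, .single (turn_order r s (.move d) ρ), ?_⟩
  rw [h.worker]
  exact h.setWorker ρ _

theorem run_build (h : Shows n f w s) (ρ : Row) (blank : f (w ρ) = none)
    (permitted : ρ = .counter → w ρ ∈ counterTiles n) :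
    ∃ s', (game r).Run
        (List.replicate (max (buildTurns r ρ) 1) (order (.build (project ρ)) ρ)) s s' ∧
      Shows n (Function.update f (w ρ) (some ρ)) w s' := by
  refine ⟨_, ?_, h.setImprovement (w ρ) (some ρ)⟩
  have run := CivGame.run_build (G := game r) (o := order (.build (project ρ)) ρ)
    (before := fun x => s.setWorker x ρ)
    (after := fun x => (s.setImprovement (w ρ) (improvement (some ρ))).setWorker x ρ)
    (p := project ρ) (cost := buildTurns r ρ) (h := w ρ) fun job => by
      have blank' := h.improvementAt_eq_iff.2 blank
      refine (turn_order ..).trans ?_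
      rw [show (s.setWorker ⟨w ρ, job⟩ ρ).worker ρ = ⟨w ρ, job⟩ by cases ρ <;> rfl,
        workerTurn_build r ρ (by cases ρ <;> exact blank') (by
          rintro rfl
          exact ⟨h.owned ▸ permitted rfl, h.desert ▸ permitted rfl, h.terraforming⟩)]
      dsimp only [Option.map_some]
      split_ifs <;> cases ρ <;> rfl
  rwa [h.setWorker_self, (h.setImprovement _ _).setWorker_self] at run

theorem run_remove (h : Shows n f w s) (ρ : Row) (improved : f (w ρ) ≠ none) :
    ∃ s', (game r).Run [order .remove ρ] s s' ∧ Shows n (Function.update f (w ρ) none) w s' := by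
  refine ⟨_, .single ?_, h.setImprovement (w ρ) none⟩
  refine (turn_order r s .remove ρ).trans ?_
  rw [h.worker]
  refine (congrArg _ (if_pos (mt h.improvementAt_eq_iff.1 improved))).trans ?_
  exact congrArg some ((h.setImprovement (w ρ) none).setWorker_self ρ)

end Shows

/-- The Workers of Civ:BE build, remove and count improvements. -/
def workerInterface (r : Rules) (n : ℕ) : WorkerInterface (game r) n where
  Shows := Shows n
  obs x := ((r.terrascapeCulture + 1) * x.1, improvement x.2)
  obs_injective :=
    (mul_right_injective₀ (Nat.succ_ne_zero _)).prodMap improvement_injective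
  move ρ d := [order (.move d) ρ]
  build ρ := List.replicate (max (buildTurns r ρ) 1) (order (.build (project ρ)) ρ)
  remove ρ := [order .remove ρ]
  observe_eq h := h.observe_eq
  run_move ρ d h := h.run_move ρ d
  run_build ρ h := h.run_build ρ
  run_remove ρ h := h.run_remove ρ

/-- The state in which the counter is `0` and the word `l` is on the tape. -/
def initialState (n : ℕ) (l : List Bool) : State where
  desert := counterTiles n
  owned := counterTiles n
  worked := counterTiles n
  terraforming := true
  ecoscaping := true
  improved := tapeImprovements improvement l
  stateWorker := ⟨(0, 1), none⟩
  tapeWorker := ⟨(0, 0), none⟩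
  rover := (0, 0)

theorem shows_initialState (n : ℕ) (l : List Bool) :
    Shows n (board 0 (Turing.Tape.mk₁ l) 0) (positions 0 0) (initialState n l) where
  desert := rfl
  owned := rfl
  worked := rfl
  terraforming := rfl
  ecoscaping := rfl
  improvementAt := funext (lookup_tapeImprovements improvement l)
  worker ρ := by cases ρ <;> rfl

theorem valid_initialState (n : ℕ) (l : List Bool) : Valid (initialState n l) where
  worked_nodup := nodup_counterTiles n
  worked_owned _ hh := hh
  terrascape h hh := by
    have := ((shows_initialState n l).improvementAt_eq_iff (c := some .counter)).1 hh
    grind [board, tapeCell]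
  pillaged h hh := by
    rw [(shows_initialState n l).improvementAt] at hh
    exact absurd hh (improvement_ne_pillagedRoad _)
  stateWorker_idle := rfl
  tapeWorker_idle := rfl

theorem computable_initialState (n : ℕ) : Computable (initialState n) := by
  have primrec_equiv : Primrec fun l : List Bool => State.equiv (initialState n l) :=
    (Primrec.const _).pair <| (Primrec.const _).pair <| (Primrec.const _).pair <|
      (Primrec.const _).pair <| (Primrec.const _).pair <|
        (primrec_tapeImprovements improvement).pair <| Primrec.const
          ((⟨(0, 1), none⟩ : Worker Project), (⟨(0, 0), none⟩ : Worker Project), ((0, 0) : Hex))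
  exact ((Primrec.of_equiv_symm (e := State.equiv)).comp primrec_equiv).to_comp

theorem exists_simulatesUniversal (r : Rules) : ∃ T : CommandTable (ℕ × Improvement) Order,
    (game r).SimulatesUniversal T ∧ (game r).UndecidableUnder T :=
  TapeInterface.exists_simulatesUniversal fun n =>
    ⟨(workerInterface r n).tapeInterface, initialState n, computable_initialState n, fun l =>
      ⟨valid_initialState n l, Nat.zero_le n, 0, shows_initialState n l⟩⟩

end CivBE

namespace CivV

open CivGame

/-- The content of a tile in Civ:V: the counter is built of Railroads, the tape of Roads. -/
def improvement : Option Row → Improvement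
  | none => .unimproved
  | some .counter => .railroad
  | some .tape => .road

theorem improvement_injective : Function.Injective improvement := by
  rintro (_ | _ | _) (_ | _ | _) <;> simp [improvement]

/-- What the Worker of a row builds. -/
def project : Row → Project
  | .counter => .railroad
  | .tape => .road

/-- The number of turns that the Worker of a row needs to build. -/
def buildTurns (r : Rules) : Row → ℕ
  | .counter => r.railroadTurns
  | .tape => r.roadTurns

/-- The Worker of a row. -/
def State.worker (s : State) : Row → Worker Project
  | .counter => s.stateWorker
  | .tape => s.tapeWorker

/-- Replace the Worker of a row. -/
def State.setWorker (s : State) (w : Worker Project) : Row → State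
  | .counter => { s with stateWorker := w }
  | .tape => { s with tapeWorker := w }

/-- An order only for the Worker of a row. -/
def order (o : WorkerOrder) : Row → Order
  | .counter => ⟨o, .wait⟩
  | .tape => ⟨.wait, o⟩

theorem State.improvementAt_setImprovement (s : State) (h : Hex) (i : Improvement) :
    (s.setImprovement h i).improvementAt = Function.update s.improvementAt h i := by
  funext h'
  by_cases hh : h' = h
  · subst hh
    simp [improvementAt, setImprovement]
  · simp [improvementAt, setImprovement, List.lookup_cons, beq_eq_false_iff_ne.2 hh, hh]

theorem turn_order (r : Rules) (s : State) (o : WorkerOrder) (ρ : Row) :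
    turn r s (order o ρ) =
      (workerTurn r s (s.worker ρ) o).map fun x => x.1.setWorker x.2 ρ := by
  cases ρ <;> exact Option.map_eq_bind.symm

theorem workerTurn_build (r : Rules) {s : State} {w : Worker Project} (ρ : Row)
    (blank : s.improvementAt w.pos = .unimproved)
    (engineering : ρ = .counter → s.engineering = true) :
    workerTurn r s w (.build (project ρ)) =
      let x := w.work (project ρ) (buildTurns r ρ)
      some (if x.2 then s.setImprovement w.pos (improvement (some ρ)) else s, x.1) := by
  cases ρ with
  | counter => exact if_pos ⟨blank, engineering rfl⟩
  | tape => exact if_pos blank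

/-- The tiles of the counter are owned, the improvements are given by `f`, and the Workers are idle
on the tiles `w`. -/
structure Shows (n : ℕ) (f : Hex → Option Row) (w : Row → Hex) (s : State) : Prop where
  owned : s.owned = counterTiles n
  engineering : s.engineering = true
  improvementAt : s.improvementAt = improvement ∘ f
  worker : ∀ ρ, s.worker ρ = ⟨w ρ, none⟩

namespace Shows

variable {r : Rules} {n : ℕ} {f : Hex → Option Row} {w : Row → Hex} {s : State}

theorem improvementAt_eq_iff (h : Shows n f w s) {x : Hex} {c : Option Row} :
    s.improvementAt x = improvement c ↔ f x = c := by
  rw [h.improvementAt, Function.comp_apply, improvement_injective.eq_iff]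

theorem setWorker (h : Shows n f w s) (ρ : Row) (x : Hex) :
    Shows n f (Function.update w ρ x) (s.setWorker ⟨x, none⟩ ρ) := by
  obtain ⟨owned, engineering, improvementAt, worker⟩ := h
  have := worker .counter
  have := worker .tape
  cases ρ <;> refine ⟨owned, engineering, improvementAt, ?_⟩ <;>
    rintro (_ | _) <;> simp_all [State.setWorker, State.worker]

theorem setWorker_self (h : Shows n f w s) (ρ : Row) : s.setWorker ⟨w ρ, none⟩ ρ = s := by
  rw [← h.worker]
  cases ρ <;> rfl

theorem setImprovement (h : Shows n f w s) (x : Hex) (c : Option Row) :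
    Shows n (Function.update f x c) w (s.setImprovement x (improvement c)) where
  owned := h.owned
  engineering := h.engineering
  improvementAt := by
    rw [State.improvementAt_setImprovement, h.improvementAt, Function.comp_update]
  worker ρ := by
    rw [← h.worker ρ]
    cases ρ <;> rfl

theorem observe_eq (h : Shows n f w s) :
    observe s =
      ((counterTiles n).countP (fun x => f x = some .counter), improvement (f (w .tape))) := by
  have railroad_iff (x : Hex) : s.improvementAt x = .railroad ↔ f x = some .counter :=
    h.improvementAt_eq_iff (c := some .counter)
  have pos_eq : s.tapeWorker.pos = w .tape := congrArg Worker.pos (h.worker .tape)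
  simp only [observe, State.railroads, h.owned, railroad_iff, pos_eq]
  rw [h.improvementAt, Function.comp_apply]

theorem run_move (h : Shows n f w s) (ρ : Row) (d : HexDir) :
    ∃ s', (game r).Run [order (.move d) ρ] s s' ∧
      Shows n f (Function.update w ρ (w ρ + d.vec)) s' := by
  refine ⟨_, .single (turn_order r s (.move d) ρ), ?_⟩
  rw [h.worker]
  exact h.setWorker ρ _

theorem run_build (h : Shows n f w s) (ρ : Row) (blank : f (w ρ) = none) :
    ∃ s', (game r).Run
        (List.replicate (max (buildTurns r ρ) 1) (order (.build (project ρ)) ρ)) s s' ∧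
      Shows n (Function.update f (w ρ) (some ρ)) w s' := by
  refine ⟨_, ?_, h.setImprovement (w ρ) (some ρ)⟩
  have run := CivGame.run_build (G := game r) (o := order (.build (project ρ)) ρ)
    (before := fun x => s.setWorker x ρ)
    (after := fun x => (s.setImprovement (w ρ) (improvement (some ρ))).setWorker x ρ)
    (p := project ρ) (cost := buildTurns r ρ) (h := w ρ) fun job => by
      have blank' := h.improvementAt_eq_iff.2 blank
      refine (turn_order ..).trans ?_
      rw [show (s.setWorker ⟨w ρ, job⟩ ρ).worker ρ = ⟨w ρ, job⟩ by cases ρ <;> rfl,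
        workerTurn_build r ρ (by cases ρ <;> exact blank') fun _ => by
          cases ρ <;> exact h.engineering]
      dsimp only [Option.map_some]
      split_ifs <;> cases ρ <;> rfl
  rwa [h.setWorker_self, (h.setImprovement _ _).setWorker_self] at run

theorem run_remove (h : Shows n f w s) (ρ : Row) (improved : f (w ρ) ≠ none) :
    ∃ s', (game r).Run [order .remove ρ] s s' ∧ Shows n (Function.update f (w ρ) none) w s' := by
  refine ⟨_, .single ?_, h.setImprovement (w ρ) none⟩
  refine (turn_order r s .remove ρ).trans ?_
  rw [h.worker]
  refine (congrArg _ (if_pos (mt h.improvementAt_eq_iff.1 improved))).trans ?_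
  exact congrArg some ((h.setImprovement (w ρ) none).setWorker_self ρ)

end Shows

/-- The Workers of Civ:V build, remove and count improvements. -/
def workerInterface (r : Rules) (n : ℕ) : WorkerInterface (game r) n where
  Shows := Shows n
  obs x := (x.1, improvement x.2)
  obs_injective := Function.injective_id.prodMap improvement_injective
  move ρ d := [order (.move d) ρ]
  build ρ := List.replicate (max (buildTurns r ρ) 1) (order (.build (project ρ)) ρ)
  remove ρ := [order .remove ρ]
  observe_eq h := h.observe_eq
  run_move ρ d h := h.run_move ρ d
  run_build ρ h blank _ := h.run_build ρ blank
  run_remove ρ h := h.run_remove ρ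

/-- The state in which the counter is `0` and the word `l` is on the tape. -/
def initialState (n : ℕ) (l : List Bool) : State where
  owned := counterTiles n
  engineering := true
  improved := tapeImprovements improvement l
  stateWorker := ⟨(0, 1), none⟩
  tapeWorker := ⟨(0, 0), none⟩

theorem shows_initialState (n : ℕ) (l : List Bool) :
    Shows n (board 0 (Turing.Tape.mk₁ l) 0) (positions 0 0) (initialState n l) where
  owned := rfl
  engineering := rfl
  improvementAt := funext (lookup_tapeImprovements improvement l)
  worker ρ := by cases ρ <;> rfl

theorem valid_initialState (n : ℕ) (l : List Bool) : Valid (initialState n l) where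
  owned_nodup := nodup_counterTiles n
  stateWorker_idle := rfl
  tapeWorker_idle := rfl

theorem computable_initialState (n : ℕ) : Computable (initialState n) := by
  have primrec_equiv : Primrec fun l : List Bool => State.equiv (initialState n l) :=
    (Primrec.const _).pair <| (Primrec.const _).pair <|
      (primrec_tapeImprovements improvement).pair <| Primrec.const
        ((⟨(0, 1), none⟩ : Worker Project), (⟨(0, 0), none⟩ : Worker Project))
  exact ((Primrec.of_equiv_symm (e := State.equiv)).comp primrec_equiv).to_comp

theorem exists_simulatesUniversal (r : Rules) : ∃ T : CommandTable (ℕ × Improvement) Order,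
    (game r).SimulatesUniversal T ∧ (game r).UndecidableUnder T :=
  TapeInterface.exists_simulatesUniversal fun n =>
    ⟨(workerInterface r n).tapeInterface, initialState n, computable_initialState n, fun l =>
      ⟨valid_initialState n l, Nat.zero_le n, 0, shows_initialState n l⟩⟩

end CivV

namespace CivVI

open CivGame Turing Relation

section Layout

/-- The offset from a City of the tile on which its free Citizen works when the City shows the
symbol `b`. A new Citizen of a City on the grassland strip chooses `spot true`. -/
def spot (b : Bool) : Hex := cond b (1, -1) (0, -1)

/-- The tiles of a City: its own tile and the adjacent ones. -/
def cityTiles (p : Hex) : List Hex := p :: Hex.neighbors p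

/-- The tiles on which Cities stand: `Sum.inl x` is position `x` of the tape, on the grassland
strip, and `Sum.inr j` is digit `j` of the unary counter. -/
def site : ℤ ⊕ ℕ → Hex
  | .inl x => (4 * x, 0)
  | .inr j => (4 * j, 8)

/-- What the player can change about a City with at most two Citizens: the symbol it shows (`none`
for a single Citizen, who works the City itself), the stored Food, the growth cap, and the progress
of a Settler. -/
structure Status where
  symbol : Option Bool
  food : ℕ
  cap : Option ℕ
  progress : ℕ

/-- The City with a given status on the tile `p`. -/
def Status.city (c : Status) (p : Hex) : City where
  center := p
  tiles := cityTiles p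
  population := c.symbol.toList.length + 1
  worked := c.symbol.toList.map (p + spot ·)
  food := c.food
  cap := c.cap
  settlerProgress := c.progress

/-- The growth of the City is stopped by its cap. -/
def Status.Capped (c : Status) : Prop := ∃ k ∈ c.cap, k ≤ c.symbol.toList.length + 1

/-- The status after one turn of growth of a City on the grassland strip with a single Citizen. -/
def Status.grown (r : Rules) (c : Status) : Status :=
  if r.growthFood 1 ≤ c.food + 2 then
    { c with symbol := some true, food := c.food + 2 - r.growthFood 1 }
  else { c with food := c.food + 2 }

/-- The tiles with a Monastery: those for `true` next to the Cities of a counter with `n` digits. -/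
def monasteries (n : ℕ) : List Hex := (List.range n).map fun j => site (.inr j) + spot true

/-- The state with Cities of status `f p` on the sites `p` of the list `I`. -/
def layout (n : ℕ) (I : List (ℤ ⊕ ℕ)) (f : ℤ ⊕ ℕ → Status) (w : Hex) (st : Option Hex) : State :=
  ⟨I.map fun p => (f p).city (site p), monasteries n, [], w, st⟩

theorem natAbs_sub_le_of_mem_cityTiles {h p : Hex} (hh : h ∈ cityTiles p) :
    (h.1 - p.1).natAbs ≤ 1 ∧ (h.2 - p.2).natAbs ≤ 1 := by
  obtain ⟨x, y⟩ := p
  simp only [cityTiles, Hex.neighbors, HexDir.vec, List.map_cons, List.map_nil, List.mem_cons,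
    List.not_mem_nil, or_false, Prod.mk_add_mk] at hh
  rcases hh with rfl | rfl | rfl | rfl | rfl | rfl | rfl <;> constructor <;> dsimp only <;> omega

theorem self_mem_cityTiles (p : Hex) : p ∈ cityTiles p := List.mem_cons_self

theorem add_spot_mem_cityTiles (p : Hex) (b : Bool) : p + spot b ∈ cityTiles p := by
  cases b <;> simp [spot, cityTiles, Hex.neighbors, HexDir.vec]

theorem add_spot_ne_self (p : Hex) (b : Bool) : p + spot b ≠ p := by
  cases b <;> simp [spot]

theorem add_spot_inj {p : Hex} {b b' : Bool} : p + spot b = p + spot b' ↔ b = b' := by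
  cases b <;> cases b' <;> simp [spot]

theorem eq_of_mem_cityTiles {p q : ℤ ⊕ ℕ} {h : Hex} (hp : h ∈ cityTiles (site p))
    (hq : h ∈ cityTiles (site q)) : p = q := by
  have hp := natAbs_sub_le_of_mem_cityTiles hp
  have hq := natAbs_sub_le_of_mem_cityTiles hq
  rcases p with x | i <;> rcases q with y | j <;> simp only [site] at hp hq
  · rw [show x = y by omega]
  · omega
  · omega
  · rw [show i = j by omega]

theorem four_le_dist_site {p q : ℤ ⊕ ℕ} (h : p ≠ q) : 4 ≤ Hex.dist (site p) (site q) := by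
  rcases p with x | i <;> rcases q with y | j <;>
    simp only [ne_eq, Sum.inl.injEq, Sum.inr.injEq] at h <;> simp only [Hex.dist, site] <;> omega

theorem notMem_monasteries {n : ℕ} {x : ℤ} {h : Hex} (hh : h ∈ cityTiles (site (.inl x))) :
    h ∉ monasteries n := by
  intro hmon
  obtain ⟨j, -, rfl⟩ := List.mem_map.1 hmon
  exact nomatch eq_of_mem_cityTiles hh (add_spot_mem_cityTiles _ _)

theorem Status.valid_city (c : Status) (p : Hex) : (c.city p).Valid where
  center_mem := self_mem_cityTiles p
  tiles_nodup := by simp [city, cityTiles, Hex.neighbors, HexDir.vec]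
  tiles_dist h hh := by
    have := natAbs_sub_le_of_mem_cityTiles hh
    simp only [city, Hex.dist]
    omega
  worked_nodup := by cases h : c.symbol <;> simp [city, h]
  worked_tiles h hh := by
    obtain ⟨b, -, rfl⟩ := List.mem_map.1 hh
    exact ⟨add_spot_mem_cityTiles p b, add_spot_ne_self p b⟩
  population_eq := by simp [city]

variable {n : ℕ} {I : List (ℤ ⊕ ℕ)} {f : ℤ ⊕ ℕ → Status} {w : Hex} {st : Option Hex} {p : ℤ ⊕ ℕ}
  {h : Hex}

theorem cityAt_layout (hp : p ∈ I) (hh : h ∈ cityTiles (site p)) :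
    (layout n I f w st).cityAt h = some ((f p).city (site p)) := by
  simp only [layout, State.cityAt]
  induction I with
  | nil => simp at hp
  | cons q I ih =>
    rw [List.map_cons, List.find?_cons]
    by_cases hq : h ∈ cityTiles (site q)
    · rw [eq_of_mem_cityTiles hq hh]
      simp [Status.city, hh]
    · have hpq : p ≠ q := by
        rintro rfl
        exact hq hh
      simp only [Status.city, hq, decide_false]
      exact ih (by simpa [hpq] using hp)

theorem cityAt_layout_eq_none (hI : p ∉ I) (hh : h ∈ cityTiles (site p)) :
    (layout n I f w st).cityAt h = none := by
  simp only [layout, State.cityAt, List.find?_eq_none, List.mem_map]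
  rintro _ ⟨q, hq, rfl⟩
  exact mt of_decide_eq_true fun hh' => hI (eq_of_mem_cityTiles hh hh' ▸ hq)

theorem setCity_layout (c : Status) : (layout n I f w st).setCity (c.city (site p)) =
    layout n I (Function.update f p c) w st := by
  simp only [layout, State.setCity, List.map_map]
  congr 1
  refine List.map_congr_left fun q _ => ?_
  by_cases hq : q = p
  · simp [hq, Status.city]
  · have hsite : site q ≠ site p := fun e =>
      hq (eq_of_mem_cityTiles (self_mem_cityTiles _) (e ▸ self_mem_cityTiles _))
    simp [hq, hsite, Status.city]

theorem reassign_layout (hp : p ∈ I) {b : Bool} (hb : (f p).symbol = some b) :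
    reassign (layout n I f w st) (site p + spot b) (site p + spot !b) =
      some (layout n I (Function.update f p { f p with symbol := some !b }) w st) := by
  simp only [reassign, cityAt_layout hp (add_spot_mem_cityTiles _ b), Option.bind_eq_bind,
    Option.bind_some]
  have free : site p + spot (!b) ∉ ((f p).city (site p)).worked := by
    simp only [Status.city, hb, Option.toList, List.map_cons, List.map_nil, List.mem_singleton]
    exact add_spot_inj.not.2 (Bool.not_ne_self b)
  rw [if_pos ⟨by simp [Status.city, hb], add_spot_mem_cityTiles _ _, free, add_spot_ne_self _ _⟩,
    ← setCity_layout]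
  simp [Status.city, hb]

theorem setCap_layout (hp : p ∈ I) (hh : h ∈ cityTiles (site p)) (k : ℕ) :
    setCap (layout n I f w st) h k =
      some (layout n I (Function.update f p { f p with cap := some k }) w st) := by
  simp only [setCap, cityAt_layout hp hh, Option.bind_eq_bind, Option.bind_some, ← setCity_layout]
  rfl

theorem train_layout (r : Rules) (hp : p ∈ I) {b : Bool} (hb : (f p).symbol = some b)
    (hh : h ∈ cityTiles (site p)) :
    CivVI.train r (layout n I f w none) h (site p + spot b) =
      some (if 30 * I.length + 50 ≤ (f p).progress + r.production then
        layout n I (Function.update f p { f p with symbol := none, progress := 0 }) w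
          (some (site p))
      else layout n I (Function.update f p
        { f p with progress := (f p).progress + r.production }) w none) := by
  have cost_eq : (layout n I f w none).settlerCost = 30 * I.length + 50 := by
    simp [State.settlerCost, layout]
  simp only [CivVI.train, cityAt_layout hp hh, cost_eq, Option.bind_eq_bind, Option.bind_some]
  rw [if_pos ⟨by simp [Status.city, hb], by simp [Status.city, hb], rfl⟩, ← setCity_layout,
    ← setCity_layout]
  simp only [Status.city, hb, Option.toList, List.map_cons, List.map_nil, List.erase_cons_head]
  split_ifs <;> rfl

theorem placeCitizen_of_grassland (s : State) {c : City} {x : ℤ} (hcenter : c.center = (x, 0))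
    (htiles : c.tiles = cityTiles (x, 0)) (hworked : c.worked = []) (hfarms : s.farms = [])
    (hmonasteries : ∀ h ∈ cityTiles (x, 0), h ∉ s.monasteries) :
    s.placeCitizen c = { c with worked := [((x, 0) : Hex) + spot true] } := by
  have yield_eq : ∀ h ∈ cityTiles (x, 0),
      s.tileFood h + s.tileFaith h = if h.2 = 0 then 2 else 3 := by
    intro h hh
    by_cases grassland : h.2 = 0 <;>
      simp [State.tileFood, State.tileFaith, hfarms, hmonasteries h hh, terrainFood, IsGrassland,
        grassland]
  have free_eq : (c.tiles.filter fun h => h ≠ c.center ∧ h ∉ c.worked) =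
      Hex.neighbors (x, 0) := by
    rw [htiles, hcenter, hworked]
    simp [cityTiles, Hex.neighbors, HexDir.vec]
  have best_eq : (Hex.neighbors (x, 0)).argmax (fun h => s.tileFood h + s.tileFaith h) =
      some ((x, 0) + spot true) := by
    simp [cityTiles, Hex.neighbors, HexDir.vec] at yield_eq
    simp [Hex.neighbors, HexDir.vec, List.argmax, List.argAux, yield_eq, spot]
  rw [State.placeCitizen, free_eq, best_eq, hworked]

theorem found_layout {x : ℤ} (hx : .inl x ∉ I) :
    settlerTurn (layout n I f w (some (site (.inl x)))) .found =
      some (layout n (.inl x :: I)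
        (Function.update f (.inl x) ⟨some true, 0, none, 0⟩) w none) := by
  have unowned : ∀ h ∈ cityTiles (site (.inl x)),
      (layout n I f w (some (site (.inl x)))).cityAt h = none := fun h =>
    cityAt_layout_eq_none hx
  have far : ∀ c ∈ (layout n I f w (some (site (.inl x)))).cities,
      4 ≤ Hex.dist (site (.inl x)) c.center := by
    intro c hc
    obtain ⟨q, hq, rfl⟩ := List.mem_map.1 hc
    exact four_le_dist_site (by rintro rfl; exact hx hq)
  have tiles_eq : ((Hex.neighbors (site (.inl x))).filter fun h =>
      ((layout n I f w (some (site (.inl x)))).cityAt h).isNone) = Hex.neighbors (site (.inl x)) :=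
    List.filter_eq_self.2 fun h hh => by rw [unowned h (List.mem_cons_of_mem _ hh)]; rfl
  have map_eq : (I.map fun q =>
      (Function.update f (.inl x) ⟨some true, 0, none, 0⟩ q).city (site q)) =
        I.map fun q => (f q).city (site q) :=
    List.map_congr_left fun q hq => by
      rw [Function.update_of_ne (by rintro rfl; exact hx hq)]
  have settler_eq : (layout n I f w (some (site (.inl x)))).settler = some (site (.inl x)) := rfl
  simp only [settlerTurn, settler_eq, Option.bind_eq_bind, Option.bind_some]
  rw [if_pos ⟨unowned _ (self_mem_cityTiles _), far⟩, tiles_eq,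
    placeCitizen_of_grassland _ rfl rfl rfl rfl fun _ => notMem_monasteries]
  simp only [layout, List.map_cons, map_eq, Function.update_self]
  rfl

/-- The end of a turn: the Cities grow. -/
def State.endTurn (r : Rules) (s : State) : State := { s with cities := s.cities.map (s.grow r) }

theorem endTurn_layout (r : Rules) (hI : ∀ q ∈ I, (f q).Capped) :
    (layout n I f w st).endTurn r = layout n I f w st := by
  simp only [State.endTurn, layout, List.map_map]
  congr 1
  exact List.map_congr_left fun q hq => if_pos (hI q hq)

theorem grow_layout_of_grassland (r : Rules) {x : ℤ} {c : Status} (hsymbol : c.symbol = none)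
    (hcap : c.cap = some 2) : (layout n I f w st).grow r (c.city (site (.inl x))) =
      (c.grown r).city (site (.inl x)) := by
  have food_eq : (layout n I f w st).cityFood (c.city (site (.inl x))) = 4 := by
    simp [State.cityFood, Status.city, hsymbol, terrainFood, IsGrassland, site]
  obtain ⟨_, food, _, progress⟩ := c
  subst hsymbol hcap
  unfold State.grow
  rw [if_neg (by simp [Status.city]), food_eq]
  simp only [Status.city, Option.toList, List.length_nil, List.map_nil, zero_add, mul_one,
    Nat.reduceSub, Nat.reduceAdd]
  rw [placeCitizen_of_grassland _ rfl rfl rfl rfl fun _ => notMem_monasteries]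
  unfold Status.grown
  split_ifs <;> rfl

theorem endTurn_layout_grown (r : Rules) {x : ℤ} (hI : ∀ q ∈ I, q ≠ .inl x → (f q).Capped)
    (hsymbol : (f (.inl x)).symbol = none) (hcap : (f (.inl x)).cap = some 2) :
    (layout n I f w st).endTurn r =
      layout n I (Function.update f (.inl x) ((f (.inl x)).grown r)) w st := by
  have grow_eq : (layout n I f w st).grow r ((f (.inl x)).city (site (.inl x))) =
      ((f (.inl x)).grown r).city (site (.inl x)) := grow_layout_of_grassland r hsymbol hcap
  simp only [layout] at grow_eq
  simp only [State.endTurn, layout, List.map_map]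
  congr 1
  refine List.map_congr_left fun q hq => ?_
  by_cases hqx : q = .inl x
  · subst hqx
    simp [grow_eq]
  · simp only [Function.comp_apply, Function.update_of_ne hqx]
    exact if_pos (hI q hq hqx)

end Layout

section Board

/-- The City that records a digit of the counter when its value is `k`: the digits below `k` are
set, so that their Citizens work Monasteries. -/
def digit (k j : ℕ) : Status := ⟨some (decide (j < k)), 0, some 2, 0⟩

/-- The sites in use: the tape positions `J` and the `n` digits of the counter. -/
def sites (n : ℕ) (J : List ℤ) : List (ℤ ⊕ ℕ) := J.map .inl ++ (List.range n).map .inr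

/-- The state in which the counter has the value `k` and the Cities at the tape positions `x ∈ J`
have status `t x`. -/
def board (n k : ℕ) (J : List ℤ) (t : ℤ → Status) (w : Hex) (st : Option Hex) : State :=
  layout n (sites n J) (Sum.elim t (digit k)) w st

/-- Where the Worker stands to read the tape position `x`. -/
def post (x : ℤ) : Hex := site (.inl x) + spot true

/-- No City on the tape grows. -/
def Settled (J : List ℤ) (t : ℤ → Status) : Prop := ∀ x ∈ J, (t x).Capped

/-- What there is to see at the tape position `x`: the symbol shown by the City, if there is one. -/
def sight (J : List ℤ) (t : ℤ → Status) (x : ℤ) : Option (Option Bool) :=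
  if x ∈ J then some (t x).symbol else none

/-- The observation of the value `k` of the counter, of the symbol shown by the City at the
position of the Worker, if there is one, and of whether there is a Settler. -/
def obsOf (k : ℕ) (c : Option (Option Bool)) (settler : Bool) : Obs where
  faith := 2 * k
  isWorked := decide (c = some (some true))
  city := c.map fun b => (b.toList.length + 1, spot true)
  settler := settler

theorem obsOf_inj {k k' : ℕ} {c c' : Option (Option Bool)} {settler settler' : Bool} :
    obsOf k c settler = obsOf k' c' settler' ↔ k = k' ∧ c = c' ∧ settler = settler' := by
  refine ⟨fun h => ?_, by rintro ⟨rfl, rfl, rfl⟩; rfl⟩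
  simp only [obsOf, Obs.mk.injEq] at h
  obtain ⟨faith_eq, isWorked_eq, city_eq, settler_eq⟩ := h
  refine ⟨by omega, ?_, settler_eq⟩
  rcases c with _ | _ | _ | _ <;> rcases c' with _ | _ | _ | _ <;> simp_all

theorem Status.Capped.set_symbol {c : Status} (hc : c.Capped) {b : Bool} (hb : c.symbol = some b)
    (a : Bool) : Status.Capped { c with symbol := some a } := by
  simpa [Status.Capped, hb] using hc

theorem digit_capped (k j : ℕ) : (digit k j).Capped := ⟨2, rfl, le_rfl⟩

theorem update_digit_succ (k : ℕ) :
    Function.update (digit k) k ⟨some true, 0, some 2, 0⟩ = digit (k + 1) := by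
  funext j
  by_cases hj : j = k
  · simp [hj, digit]
  · have lt_iff : j < k ↔ j < k + 1 := by omega
    simp [hj, digit, lt_iff]

theorem update_digit_self (k : ℕ) :
    Function.update (digit (k + 1)) k ⟨some false, 0, some 2, 0⟩ = digit k := by
  rw [← update_digit_succ, Function.update_idem, Function.update_eq_self_iff]
  simp [digit]

variable {n k k' : ℕ} {J : List ℤ} {t : ℤ → Status} {w : Hex} {st : Option Hex} {x : ℤ} {j : ℕ}

theorem inl_mem_sites : .inl x ∈ sites n J ↔ x ∈ J := by simp [sites]

theorem inr_mem_sites : .inr j ∈ sites n J ↔ j < n := by simp [sites]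

theorem length_sites : (sites n J).length = J.length + n := by simp [sites]

theorem layout_update_inl (c : Status) :
    layout n (sites n J) (Function.update (Sum.elim t (digit k)) (.inl x) c) w st =
      board n k J (Function.update t x c) w st := by
  rw [board, Sum.update_elim_inl]

theorem add_spot_mem_monasteries (hj : j < n) (b : Bool) :
    site (.inr j) + spot b ∈ monasteries n ↔ b = true := by
  constructor
  · intro h
    obtain ⟨i, -, hi⟩ := List.mem_map.1 h
    obtain rfl : i = j := Sum.inr_injective <|
      eq_of_mem_cityTiles (add_spot_mem_cityTiles _ _) (hi.symm ▸ add_spot_mem_cityTiles _ _)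
    exact (add_spot_inj.1 hi).symm
  · rintro rfl
    exact List.mem_map.2 ⟨j, List.mem_range.2 hj, rfl⟩

theorem faith_board (r : Rules) (hk : k ≤ n) :
    (board n k J t w st).faith r = r.baseFaith + 2 * k := by
  let cityFaith (p : ℤ ⊕ ℕ) : ℕ := ((((Sum.elim t (digit k) p).city (site p)).worked).map
    (board n k J t w st).tileFaith).sum
  have tape_faith (x : ℤ) : cityFaith (.inl x) = 0 := by
    refine List.sum_eq_zero fun a ha => ?_
    obtain ⟨h, hh, rfl⟩ := List.mem_map.1 ha
    obtain ⟨b, -, rfl⟩ := List.mem_map.1 hh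
    exact if_neg (notMem_monasteries (add_spot_mem_cityTiles _ b))
  have counter_faith (j : ℕ) (hj : j < n) :
      (cityFaith ∘ Sum.inr) j = if j < k then 2 else 0 := by
    simp only [cityFaith, Function.comp_apply, Status.city, Sum.elim_inr, digit, Option.toList,
      List.map_cons, List.map_nil, List.sum_singleton, State.tileFaith, board, layout,
      add_spot_mem_monasteries hj, decide_eq_true_eq]
  have sum_eq : (((sites n J).map cityFaith).sum) = 2 * k := by
    rw [sites, List.map_append, List.sum_append, List.map_map, List.map_map,
      List.sum_eq_zero (by simp [tape_faith]),
      List.map_congr_left fun j hj => counter_faith j (List.mem_range.1 hj), List.sum_map_ite]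
    simp [← List.countP_eq_length_filter, countP_range_lt hk, mul_comm]
  rw [State.faith, ← sum_eq]
  simp only [board, layout, List.map_map]
  rfl

theorem observe_board (r : Rules) (hk : k ≤ n) :
    observe r (board n k J t (post x) st) = obsOf k (sight J t x) st.isSome := by
  have isWorked_eq : ((board n k J t (post x) st).cities.any fun c => post x ∈ c.worked) =
      decide (sight J t x = some (some true)) := by
    have worked_iff (p : ℤ ⊕ ℕ) : post x ∈ ((Sum.elim t (digit k) p).city (site p)).worked ↔
        p = .inl x ∧ (t x).symbol = some true := by
      simp only [Status.city, List.mem_map, Option.mem_toList, post]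
      constructor
      · rintro ⟨b, hb, hx⟩
        obtain rfl : p = .inl x :=
          eq_of_mem_cityTiles (hx ▸ add_spot_mem_cityTiles _ _) (add_spot_mem_cityTiles _ _)
        exact ⟨rfl, add_spot_inj.1 hx ▸ hb⟩
      · rintro ⟨rfl, hb⟩
        exact ⟨true, hb, rfl⟩
    rw [Bool.eq_iff_iff]
    simp [board, layout, worked_iff, inl_mem_sites, sight]
  have city_eq : (board n k J t (post x) st).cityAt (post x) =
      if x ∈ J then some ((t x).city (site (.inl x))) else none := by
    split_ifs with hx
    · exact cityAt_layout (inl_mem_sites.2 hx) (add_spot_mem_cityTiles _ _)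
    · exact cityAt_layout_eq_none (inl_mem_sites.not.2 hx) (add_spot_mem_cityTiles _ _)
  have worker_eq : (board n k J t (post x) st).worker = post x := rfl
  simp only [observe, faith_board r hk, worker_eq, isWorked_eq, city_eq, obsOf, sight]
  split_ifs <;> simp [board, layout, Status.city, post]

theorem Settled.update (h : Settled J t) {c : Status} (hc : c.Capped) :
    Settled J (Function.update t x c) := by
  intro y hy
  by_cases hyx : y = x
  · simpa [hyx] using hc
  · simpa [hyx] using h y hy

theorem Settled.cons (h : Settled J t) {c : Status} (hc : c.Capped) :
    Settled (x :: J) (Function.update t x c) := by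
  intro y hy
  by_cases hyx : y = x
  · simpa [hyx] using hc
  · simpa [hyx] using h y (List.mem_of_ne_of_mem hyx hy)

theorem Settled.capped_of_mem_sites (h : Settled J t) :
    ∀ p ∈ sites n J, (Sum.elim t (digit k) p).Capped
  | .inl _, hp => h _ (inl_mem_sites.1 hp)
  | .inr j, _ => digit_capped k j

theorem endTurn_board (r : Rules) (h : Settled J t) :
    (board n k J t w st).endTurn r = board n k J t w st :=
  endTurn_layout r h.capped_of_mem_sites

theorem endTurn_board_grown (r : Rules) (h : ∀ y ∈ J, y ≠ x → (t y).Capped)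
    (hsymbol : (t x).symbol = none) (hcap : (t x).cap = some 2) :
    (board n k J t w st).endTurn r = board n k J (Function.update t x ((t x).grown r)) w st := by
  have capped : ∀ p ∈ sites n J, p ≠ .inl x → (Sum.elim t (digit k) p).Capped
    | .inl y, hp, hne => h y (inl_mem_sites.1 hp) fun e => hne (e ▸ rfl)
    | .inr j, _, _ => digit_capped k j
  exact (endTurn_layout_grown r capped hsymbol hcap).trans (layout_update_inl _)

end Board

section Orders

/-- No orders. -/
def noOrder : Order := ⟨none, none, [], [], none⟩

/-- Orders that move the Worker to the adjacent tape position in the direction `d`. -/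
def moveOrders (d : Dir) : List Order :=
  List.replicate 4 { noOrder with worker := some (hexDir d) }

/-- Orders that move the Settler to the adjacent tape position in the direction `d`. -/
def moveSettlerOrders (d : Dir) : List Order :=
  List.replicate 4 { noOrder with settler := some (.move (hexDir d)) }

/-- Orders that change the value of the counter from `k` to `k'`. -/
def counterOrder (k k' : ℕ) : Order :=
  { noOrder with
    citizens :=
      ((List.range k).reverse.map fun j =>
        (.absolute (site (.inr j) + spot true), .absolute (site (.inr j) + spot false))) ++
      (List.range k').map fun j =>
        (.absolute (site (.inr j) + spot false), .absolute (site (.inr j) + spot true)) }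

/-- Orders that replace the symbol `b` at the position of the Worker by `a`. -/
def writeOrders (b a : Bool) : List Order :=
  if b = a then []
  else [{ noOrder with
    citizens := [(.fromWorker (spot b - spot true), .fromWorker (spot (!b) - spot true))] }]

/-- Orders that put a cap on the growth of the City at the position of the Worker. -/
def capOrder (c : ℕ) : Order := { noOrder with caps := [(.fromWorker 0, c)] }

/-- Orders to train a Settler in the City at the position of the Worker, which shows `b`. -/
def trainOrder (b : Bool) : Order :=
  { noOrder with train := some (.fromWorker 0, .fromWorker (spot b - spot true)) }

/-- Orders that found a City at distance `4` from the Worker, in the direction `d`, and cap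
its growth. -/
def foundOrder (d : Dir) : Order :=
  { noOrder with settler := some .found, caps := [(.fromWorker (4 * step d, 0), 2)] }

theorem site_inl_add_step (x : ℤ) (d : Dir) :
    site (.inl x) + 4 • (hexDir d).vec = site (.inl (x + step d)) := by
  simp [hexDir_vec, site, mul_add]

theorem post_add_step (x : ℤ) (d : Dir) : post x + (4 * step d, 0) = post (x + step d) := by
  simp only [post, site, Prod.mk_add_mk, mul_add, add_right_comm _ (spot true), add_zero]

variable {r : Rules} {n k k' : ℕ} {J : List ℤ} {t : ℤ → Status} {w : Hex} {st : Option Hex}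
  {x : ℤ} {j : ℕ}

theorem run_replicate_move (h : Settled J t) (d : HexDir) (m : ℕ) :
    (game r).Run (List.replicate m { noOrder with worker := some d })
      (board n k J t w st) (board n k J t (w + m • d.vec) st) := by
  induction m generalizing w with
  | zero => simpa using Run.nil _
  | succ m ih =>
    have turn_eq : turn r (board n k J t w st) { noOrder with worker := some d } =
        some (board n k J t (w + d.vec) st) := congrArg some (endTurn_board r h)
    rw [succ_nsmul', ← add_assoc]
    exact (Run.single turn_eq).append ih

theorem run_replicate_moveSettler (h : Settled J t) (d : HexDir) (m : ℕ) (p : Hex) :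
    (game r).Run (List.replicate m { noOrder with settler := some (.move d) })
      (board n k J t w (some p)) (board n k J t w (some (p + m • d.vec))) := by
  induction m generalizing p with
  | zero => simpa using Run.nil _
  | succ m ih =>
    have turn_eq : turn r (board n k J t w (some p)) { noOrder with settler := some (.move d) } =
        some (board n k J t w (some (p + d.vec))) := congrArg some (endTurn_board r h)
    rw [succ_nsmul', ← add_assoc]
    exact (Run.single turn_eq).append (ih _)

theorem run_moveOrders (h : Settled J t) (d : Dir) : (game r).Run (moveOrders d)
    (board n k J t (post x) st) (board n k J t (post (x + step d)) st) := by
  have post_eq : post x + 4 • (hexDir d).vec = post (x + step d) := by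
    rw [post, add_right_comm, site_inl_add_step, post]
  exact post_eq ▸ run_replicate_move h (hexDir d) 4

theorem run_moveSettlerOrders (h : Settled J t) (d : Dir) : (game r).Run (moveSettlerOrders d)
    (board n k J t w (some (site (.inl x)))) (board n k J t w (some (site (.inl (x + step d))))) :=
  site_inl_add_step x d ▸ run_replicate_moveSettler h (hexDir d) 4 _

theorem reassign_digit_true (hk : k < n) : reassign (board n (k + 1) J t w st)
    (site (.inr k) + spot true) (site (.inr k) + spot false) = some (board n k J t w st) := by
  refine (reassign_layout (inr_mem_sites.2 hk) (by simp [digit])).trans (congrArg some ?_)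
  rw [Sum.update_elim_inr]
  exact congrArg (fun g => layout n _ (Sum.elim t g) w st) (update_digit_self k)

theorem reassign_digit_false (hk : k < n) : reassign (board n k J t w st)
    (site (.inr k) + spot false) (site (.inr k) + spot true) = some (board n (k + 1) J t w st) := by
  refine (reassign_layout (inr_mem_sites.2 hk) (by simp [digit])).trans (congrArg some ?_)
  rw [Sum.update_elim_inr]
  exact congrArg (fun g => layout n _ (Sum.elim t g) w st) (update_digit_succ k)

theorem foldlM_reassign_true (hk : k ≤ n) :
    (List.range k).reverse.foldlM (fun s j =>
      reassign s (site (.inr j) + spot true) (site (.inr j) + spot false))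
        (board n k J t w st) = some (board n 0 J t w st) := by
  induction k with
  | zero => rfl
  | succ k ih =>
    rw [List.range_succ, List.reverse_append, List.reverse_singleton, List.singleton_append,
      List.foldlM_cons, reassign_digit_true hk]
    exact ih (Nat.le_of_succ_le hk)

theorem foldlM_reassign_false (hk : k ≤ n) :
    (List.range k).foldlM (fun s j =>
      reassign s (site (.inr j) + spot false) (site (.inr j) + spot true))
        (board n 0 J t w st) = some (board n k J t w st) := by
  induction k with
  | zero => rfl
  | succ k ih =>
    rw [List.range_succ, List.foldlM_append, ih (Nat.le_of_succ_le hk)]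
    exact (bind_pure _).trans (reassign_digit_false hk)

theorem turn_citizens (s : State) (l : List (TileRef × TileRef)) :
    turn r s { noOrder with citizens := l } =
      (l.foldlM (fun s x => reassign s (s.tile x.1) (s.tile x.2)) s).map (State.endTurn r) :=
  Option.map_eq_bind.symm

theorem run_counterOrder (h : Settled J t) (hk : k ≤ n) (hk' : k' ≤ n) :
    (game r).Run [counterOrder k k'] (board n k J t w st) (board n k' J t w st) := by
  refine .single ((turn_citizens _ _).trans ?_)
  simp only [List.foldlM_append, List.foldlM_map, State.tile]
  rw [foldlM_reassign_true hk, Option.bind_eq_bind, Option.bind_some, foldlM_reassign_false hk',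
    Option.map_some, endTurn_board r h]

theorem tile_fromWorker (b : Bool) :
    (board n k J t (post x) st).tile (.fromWorker (spot b - spot true)) =
      site (.inl x) + spot b :=
  add_add_sub_cancel ..

theorem run_writeOrders (h : Settled J t) (hx : x ∈ J) {b : Bool} (hb : (t x).symbol = some b)
    (a : Bool) : (game r).Run (writeOrders b a) (board n k J t (post x) st)
      (board n k J (Function.update t x { t x with symbol := some a }) (post x) st) := by
  rw [writeOrders]
  split_ifs with hba
  · rw [← hba, ← hb, Function.update_eq_self]
    exact .nil _
  · obtain rfl : a = !b := Bool.eq_not.2 (Ne.symm hba)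
    have settled : Settled J (Function.update t x { t x with symbol := some !b }) :=
      h.update ((h x hx).set_symbol hb _)
    refine .single ((turn_citizens _ _).trans ?_)
    rw [List.foldlM_cons, tile_fromWorker, tile_fromWorker]
    refine (congrArg _ (bind_pure _)).trans ?_
    rw [board, reassign_layout (inl_mem_sites.2 hx) hb, Option.map_some]
    exact congrArg some ((congrArg _ (layout_update_inl _)).trans (endTurn_board r settled))

theorem setCap_board (hx : x ∈ J) (c : ℕ) : setCap (board n k J t w st) (post x) c =
    some (board n k J (Function.update t x { t x with cap := some c }) w st) :=
  (setCap_layout (inl_mem_sites.2 hx) (add_spot_mem_cityTiles _ _) c).trans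
    (congrArg some (layout_update_inl _))

theorem turn_capOrder (hx : x ∈ J) (c : ℕ) :
    turn r (board n k J t (post x) st) (capOrder c) =
      some ((board n k J (Function.update t x { t x with cap := some c }) (post x) st).endTurn
        r) := by
  have tile_eq : (board n k J t (post x) st).tile (.fromWorker 0) = post x := add_zero _
  simp [turn, capOrder, noOrder, tile_eq, setCap_board hx, State.endTurn]

theorem run_capOrder (h : Settled J t) (hx : x ∈ J) {c : ℕ}
    (hc : c ≤ (t x).symbol.toList.length + 1) : (game r).Run [capOrder c]
      (board n k J t (post x) st)
      (board n k J (Function.update t x { t x with cap := some c }) (post x) st) := by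
  refine .single ((turn_capOrder hx c).trans (congrArg some (endTurn_board r (h.update ?_))))
  exact ⟨c, rfl, hc⟩

theorem run_capOrder_grown (h : ∀ y ∈ J, y ≠ x → (t y).Capped) (hx : x ∈ J)
    (hsymbol : (t x).symbol = none) : (game r).Run [capOrder 2] (board n k J t (post x) st)
      (board n k J (Function.update t x (Status.grown r { t x with cap := some 2 })) (post x)
        st) := by
  refine .single ((turn_capOrder hx 2).trans (congrArg some ?_))
  rw [endTurn_board_grown r (x := x)]
  · simp
  · intro y hy hyx
    simpa [hyx] using h y hy hyx
  · simpa using hsymbol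
  · simp

theorem run_trainOrder (h : Settled J t) (hx : x ∈ J) {b : Bool} (hb : (t x).symbol = some b)
    (hcap : (t x).cap = some 1) : (game r).Run [trainOrder b] (board n k J t (post x) none)
      (if 30 * (J.length + n) + 50 ≤ (t x).progress + r.production then
        board n k J (Function.update t x { t x with symbol := none, progress := 0 }) (post x)
          (some (site (.inl x)))
      else board n k J
        (Function.update t x { t x with progress := (t x).progress + r.production }) (post x)
          none) := by
  have tile_eq : (board n k J t (post x) none).tile (.fromWorker 0) = post x := add_zero _
  have train_eq := train_layout (n := n) (I := sites n J) (f := Sum.elim t (digit k))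
    (w := post x) r (inl_mem_sites.2 hx) hb (add_spot_mem_cityTiles (site (.inl x)) true)
  simp only [length_sites, Sum.elim_inl, layout_update_inl] at train_eq
  have trained : Settled J (Function.update t x { t x with symbol := none, progress := 0 }) :=
    h.update ⟨1, hcap, le_add_self⟩
  have training :
      Settled J (Function.update t x { t x with progress := (t x).progress + r.production }) :=
    h.update (h x hx)
  have turn_eq : turn r (board n k J t (post x) none) (trainOrder b) =
      (CivVI.train r (board n k J t (post x) none)
        ((board n k J t (post x) none).tile (.fromWorker 0))
        ((board n k J t (post x) none).tile (.fromWorker (spot b - spot true)))).map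
          (State.endTurn r) := Option.map_eq_bind.symm
  rw [tile_eq, tile_fromWorker] at turn_eq
  refine .single (turn_eq.trans ((congrArg _ train_eq).trans (congrArg some ?_)))
  split_ifs
  exacts [endTurn_board r trained, endTurn_board r training]

theorem run_foundOrder (h : Settled J t) {d : Dir} (hx : x + step d ∉ J) :
    (game r).Run [foundOrder d] (board n k J t (post x) (some (site (.inl (x + step d)))))
      (board n k ((x + step d) :: J)
        (Function.update t (x + step d) ⟨some true, 0, some 2, 0⟩) (post x) none) := by
  set y := x + step d
  have found_eq : settlerTurn (board n k J t (post x) (some (site (.inl y)))) .found =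
      some (board n k (y :: J) (Function.update t y ⟨some true, 0, none, 0⟩) (post x) none) :=
    (found_layout (inl_mem_sites.not.2 hx)).trans
      (congrArg some (layout_update_inl (J := y :: J) _))
  have tile_eq :
      (board n k (y :: J) (Function.update t y ⟨some true, 0, none, 0⟩) (post x) none).tile
        (.fromWorker (4 * step d, 0)) = post y := post_add_step x d
  have setCap_eq :
      setCap (board n k (y :: J) (Function.update t y ⟨some true, 0, none, 0⟩) (post x) none)
        (post y) 2 = some (board n k (y :: J)
          (Function.update t y ⟨some true, 0, some 2, 0⟩) (post x) none) := by
    simp only [setCap_board List.mem_cons_self, Function.update_self, Function.update_idem]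
  have settled : Settled (y :: J) (Function.update t y ⟨some true, 0, some 2, 0⟩) :=
    h.cons ⟨2, rfl, le_rfl⟩
  refine .single (.trans ?_ (congrArg some (endTurn_board r settled)))
  simp only [game, turn, foundOrder, noOrder, found_eq]
  simp [tile_eq, setCap_eq, State.endTurn]

end Orders

section Phases

/-- What the table is doing: running the machine, going back to the last City of the tape, training
a Settler in this City, which shows a symbol that has to be restored later, and waiting for a new
Citizen to replace the Settler. -/
inductive Phase
  | run
  | back
  | train (b : Bool)
  | grow (b : Bool)
  deriving Fintype

instance : Fintype Dir where
  elems := {.left, .right}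
  complete := by rintro (_ | _) <;> simp

/-- What the counter records: the state of the machine, the direction of its last move, and the
phase. -/
abbrev Mode (n : ℕ) := Fin (n + 1) × Dir × Phase

/-- The number of digits of the counter. -/
def numModes (n : ℕ) : ℕ := Fintype.card (Mode n)

variable {n : ℕ}

/-- The value of the counter that stands for a mode. -/
noncomputable def code (m : Mode n) : ℕ := Fintype.equivFin (Mode n) m

theorem code_le (m : Mode n) : code m ≤ numModes n := (Fintype.equivFin (Mode n) m).isLt.le

theorem code_injective : Function.Injective (code (n := n)) :=
  Fin.val_injective.comp (Fintype.equivFin (Mode n)).injective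

/-- What the table distinguishes: the mode, the symbol shown by the City at the position of the
Worker, if there is one, and whether there is a Settler. -/
abbrev Key (n : ℕ) := Mode n × Option (Option Bool) × Bool

/-- The observation that corresponds to a key. -/
noncomputable def keyObs (k : Key n) : Obs := obsOf (code k.1) k.2.1 k.2.2

theorem keyObs_injective : Function.Injective (keyObs (n := n)) := by
  rintro ⟨m, c, settler⟩ ⟨m', c', settler'⟩ h
  obtain ⟨code_eq, rfl, rfl⟩ := obsOf_inj.1 h
  exact congrArg (·, _) (code_injective code_eq)

/-- The opposite direction. -/
def opp : Dir → Dir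
  | .left => .right
  | .right => .left

theorem step_opp (d : Dir) : step (opp d) = -step d := by cases d <;> rfl

/-- Orders that change the recorded mode. -/
noncomputable def modeOrder (m m' : Mode n) : Order := counterOrder (code m) (code m')

/-- Orders that carry out a step of the machine in the state `q`, after a move in the direction `d`
and with the symbol `b` on the tape. -/
noncomputable def stepOrders (q : Fin (n + 1)) (d : Dir) (b : Bool) (q' : Fin (n + 1)) :
    TM0.Stmt Bool → List Order
  | .move d' => moveOrders d' ++ [modeOrder (q, d, .run) (q', d', .run)]
  | .write a => writeOrders b a ++ [modeOrder (q, d, .run) (q', d, .run)]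

/-- The commands by which the player simulates the machine `M`. -/
noncomputable def command (M : TM0.Machine Bool (Fin (n + 1))) : Key n → Option (List Order)
  | ((q, d, .run), some (some b), false) => (M q b).map fun a => stepOrders q d b a.1 a.2
  | ((q, d, .run), none, false) =>
      some (moveOrders (opp d) ++ [modeOrder (q, d, .run) (q, d, .back)])
  | ((q, d, .back), some (some b), false) =>
      some ([capOrder 1] ++ [modeOrder (q, d, .back) (q, d, .train b)])
  | ((_, _, .train b), some (some _), false) => some [trainOrder b]
  | ((q, d, .train b), some none, true) => some
      (moveSettlerOrders d ++ [foundOrder d] ++ [modeOrder (q, d, .train b) (q, d, .grow b)])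
  | ((_, _, .grow _), some none, false) => some [capOrder 2]
  | ((q, d, .grow b), some (some _), false) => some
      (writeOrders true b ++ moveOrders d ++ writeOrders true false ++
        [modeOrder (q, d, .grow b) (q, d, .run)])
  | _ => none

/-- The command table by which the player simulates the machine `M`. -/
noncomputable def table (M : TM0.Machine Bool (Fin (n + 1))) : CommandTable Obs Order :=
  mkTable keyObs (command M)

/-- The state in which the mode is `m`, the Cities at the tape positions `x ∈ J` have status `t x`,
and the Worker is at the tape position `x`. -/
noncomputable def modeState (m : Mode n) (J : List ℤ) (t : ℤ → Status) (x : ℤ) (st : Option Hex) :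
    State :=
  board (numModes n) (code m) J t (post x) st

variable {M : TM0.Machine Bool (Fin (n + 1))} {r : Rules} {m m' : Mode n} {J : List ℤ}
  {t : ℤ → Status} {x : ℤ} {st : Option Hex} {q : Fin (n + 1)} {d : Dir} {b : Bool}

theorem lookup_table : (table M).lookup ((game r).observe (modeState m J t x st)) =
    command M (m, sight J t x, st.isSome) :=
  (congrArg (List.lookup · (table M)) (observe_board r (code_le m))).trans
    (lookup_mkTable keyObs_injective _ (m, _, _))

theorem run_modeOrder (h : Settled J t) : (game r).Run [modeOrder m m']
    (modeState m J t x st) (modeState m' J t x st) :=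
  run_counterOrder h (code_le m) (code_le m')

theorem round_of_run {os : List Order} {s : State}
    (run : (game r).Run os (modeState m J t x st) s)
    (hcommand : command M (m, sight J t x, st.isSome) = some os) :
    (game r).Round (table M) (modeState m J t x st) s :=
  run.round (lookup_table.trans hcommand)

theorem sight_of_mem (hx : x ∈ J) : sight J t x = some (t x).symbol := if_pos hx

theorem sight_of_notMem (hx : x ∉ J) : sight J t x = none := if_neg hx

theorem round_back (h : Settled J t) (hx : x + step d ∉ J) :
    (game r).Round (table M) (modeState (q, d, .run) J t (x + step d) none)
      (modeState (q, d, .back) J t x none) := by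
  have post_eq : x + step d + step (opp d) = x := by rw [step_opp, add_neg_cancel_right]
  have run := (run_moveOrders (r := r) (n := numModes n) (k := code (q, d, .run)) (st := none)
    (x := x + step d) h (opp d)).append (run_modeOrder (m' := (q, d, .back)) h)
  rw [post_eq] at run
  exact round_of_run run (by rw [sight_of_notMem hx]; rfl)

theorem round_stopGrowth (h : Settled J t) (hx : x ∈ J) (hb : (t x).symbol = some b) :
    (game r).Round (table M) (modeState (q, d, .back) J t x none)
      (modeState (q, d, .train b) J (Function.update t x { t x with cap := some 1 }) x none) := by
  have run := run_capOrder (r := r) (n := numModes n) (k := code (q, d, .back)) (st := none) h hx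
    (c := 1) le_add_self
  refine round_of_run (run.append (run_modeOrder (h.update ?_))) ?_
  · exact ⟨1, rfl, le_add_self⟩
  · rw [sight_of_mem hx, hb]
    rfl

theorem exists_train (h : Settled J t) (hx : x ∈ J) (hb : (t x).symbol = some b)
    (hcap : (t x).cap = some 1) : ∃ c : Status, c.symbol = none ∧ c.cap = some 1 ∧
      ReflTransGen ((game r).Round (table M)) (modeState (q, d, .train b) J t x none)
        (modeState (q, d, .train b) J (Function.update t x c) x (some (site (.inl x)))) := by
  induction hm : 30 * (J.length + numModes n) + 50 - (t x).progress
    using Nat.strong_induction_on generalizing t with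
  | _ m ih =>
    have round := round_of_run (M := M) (m := (q, d, .train b)) (st := none)
      (run_trainOrder (r := r) h hx hb hcap) (by rw [sight_of_mem hx, hb]; rfl)
    split_ifs at round with hdone
    · exact ⟨{ t x with symbol := none, progress := 0 }, rfl, hcap, .single round⟩
    · have := r.production_pos
      let c : Status := { t x with progress := (t x).progress + r.production }
      have update_self : Function.update t x c x = c := Function.update_self ..
      obtain ⟨c', symbol_eq, cap_eq, rounds⟩ :=
        ih (30 * (J.length + numModes n) + 50 - c.progress) (by simp only [c]; omega)
          (h.update (c := c) (h x hx)) (by rwa [update_self]) (by rwa [update_self])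
          (by rw [update_self])
      rw [Function.update_idem] at rounds
      exact ⟨c', symbol_eq, cap_eq, rounds.head round⟩

theorem round_found (h : Settled J t) (hx : x ∈ J) (hy : x + step d ∉ J)
    (hsymbol : (t x).symbol = none) :
    (game r).Round (table M) (modeState (q, d, .train b) J t x (some (site (.inl x))))
      (modeState (q, d, .grow b) ((x + step d) :: J)
        (Function.update t (x + step d) ⟨some true, 0, some 2, 0⟩) x none) := by
  have move := run_moveSettlerOrders (r := r) (n := numModes n) (k := code (q, d, .train b))
    (w := post x) (x := x) h d
  have found := run_foundOrder (r := r) (n := numModes n) (k := code (q, d, .train b)) h hy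
  refine round_of_run ((move.append found).append (run_modeOrder (h.cons ?_))) ?_
  · exact ⟨2, rfl, le_rfl⟩
  · rw [sight_of_mem hx, hsymbol]
    rfl

theorem exists_grow (h : ∀ y ∈ J, y ≠ x → (t y).Capped) (hx : x ∈ J)
    (hsymbol : (t x).symbol = none) : ∃ c : Status, c.symbol = some true ∧ c.cap = some 2 ∧
      ReflTransGen ((game r).Round (table M)) (modeState (q, d, .grow b) J t x none)
        (modeState (q, d, .grow b) J (Function.update t x c) x none) := by
  induction hm : r.growthFood 1 - (t x).food using Nat.strong_induction_on generalizing t with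
  | _ m ih =>
    have round := round_of_run (M := M) (m := (q, d, .grow b)) (st := none)
      (run_capOrder_grown (r := r) h hx hsymbol) (by rw [sight_of_mem hx, hsymbol]; rfl)
    simp only [Status.grown] at round
    split_ifs at round with hdone
    · exact ⟨{ t x with
        symbol := some true, food := (t x).food + 2 - r.growthFood 1, cap := some 2 },
        rfl, rfl, .single round⟩
    · let c : Status := { t x with food := (t x).food + 2, cap := some 2 }
      have update_self : Function.update t x c x = c := Function.update_self ..
      obtain ⟨c', symbol_eq, cap_eq, rounds⟩ :=
        ih (r.growthFood 1 - c.food) (by simp only [c]; omega) (t := Function.update t x c)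
          (fun y hy hyx => by simpa [hyx] using h y hy hyx) (by rwa [update_self])
          (by rw [update_self])
      rw [Function.update_idem] at rounds
      exact ⟨c', symbol_eq, cap_eq, rounds.head round⟩

theorem step_ne_zero (d : Dir) : step d ≠ 0 := by cases d <;> decide

theorem round_return (h : Settled J t) (hx : x ∈ J) (hy : x + step d ∈ J)
    (hsymbol : (t x).symbol = some true) (hsymbol' : (t (x + step d)).symbol = some true) :
    (game r).Round (table M) (modeState (q, d, .grow b) J t x none)
      (modeState (q, d, .run) J
        (Function.update (Function.update t x { t x with symbol := some b }) (x + step d)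
          { t (x + step d) with symbol := some false }) (x + step d) none) := by
  have ne : x + step d ≠ x := by simp [step_ne_zero]
  have settled : Settled J (Function.update t x { t x with symbol := some b }) :=
    h.update ((h x hx).set_symbol hsymbol b)
  have restore := run_writeOrders (r := r) (n := numModes n) (k := code (q, d, .grow b))
    (st := none) h hx hsymbol b
  have blank := run_writeOrders (r := r) (n := numModes n) (k := code (q, d, .grow b))
    (st := none) settled hy (b := true) (by rwa [Function.update_of_ne ne]) false
  rw [Function.update_of_ne ne] at blank
  refine round_of_run (((restore.append (run_moveOrders settled d)).append blank).append
    (run_modeOrder (settled.update ((h _ hy).set_symbol hsymbol' false)))) ?_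
  rw [sight_of_mem hx, hsymbol]
  rfl

/-- The Cities show the symbols `g`, and those that are missing would show the blank symbol. -/
structure ShowsTape (J : List ℤ) (t : ℤ → Status) (g : ℤ → Bool) : Prop where
  symbol_eq : ∀ x ∈ J, (t x).symbol = some (g x)
  cap_eq : ∀ x ∈ J, (t x).cap = some 2
  blank : ∀ x ∉ J, g x = false

variable {g : ℤ → Bool}

theorem ShowsTape.settled (h : ShowsTape J t g) : Settled J t := fun x hx =>
  ⟨2, h.cap_eq x hx, by simp [h.symbol_eq x hx]⟩

theorem ShowsTape.exists_settler (h : ShowsTape J t g) (hx : x ∈ J) (hy : x + step d ∉ J) :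
    ∃ c : Status, c.symbol = none ∧ c.cap = some 1 ∧ ReflTransGen ((game r).Round (table M))
      (modeState (q, d, .run) J t (x + step d) none)
      (modeState (q, d, .train (g x)) J (Function.update t x c) x (some (site (.inl x)))) := by
  have settled : Settled J (Function.update t x { t x with cap := some 1 }) :=
    h.settled.update ⟨1, rfl, le_add_self⟩
  obtain ⟨c, symbol_eq, cap_eq, train⟩ := exists_train (M := M) (r := r) (q := q) (d := d)
    (b := g x) settled hx (by simp [h.symbol_eq x hx]) (by simp)
  rw [Function.update_idem] at train
  exact ⟨c, symbol_eq, cap_eq, .head (round_back h.settled hy)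
    (.head (round_stopGrowth h.settled hx (h.symbol_eq x hx)) train)⟩

theorem ShowsTape.exists_settle (h : ShowsTape J t g) (hx : x ∈ J) (hy : x + step d ∉ J) :
    ∃ t', ReflTransGen ((game r).Round (table M))
        (modeState (q, d, .run) J t (x + step d) none)
        (modeState (q, d, .run) ((x + step d) :: J) t' (x + step d) none) ∧
      ShowsTape ((x + step d) :: J) t' g := by
  have ne : x + step d ≠ x := by simp [step_ne_zero]
  obtain ⟨c₁, symbol₁, cap₁, train⟩ := h.exists_settler (M := M) (r := r) (q := q) hx hy
  have settled₁ : Settled J (Function.update t x c₁) := h.settled.update ⟨1, cap₁, le_add_self⟩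
  have settled₂ : Settled ((x + step d) :: J)
      (Function.update (Function.update t x c₁) (x + step d) ⟨some true, 0, some 2, 0⟩) :=
    settled₁.cons ⟨2, rfl, le_rfl⟩
  have found := round_found (M := M) (r := r) (q := q) (b := g x) settled₁ hx hy (by simp [symbol₁])
  obtain ⟨c₃, symbol₃, cap₃, grow⟩ := exists_grow (M := M) (r := r) (q := q) (d := d) (b := g x)
    (fun z hz _ => settled₂ z hz) (List.mem_cons_of_mem _ hx) (by simp [ne.symm, symbol₁])
  have settled₃ := settled₂.update (x := x) (c := c₃) ⟨2, cap₃, by simp [symbol₃]⟩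
  have ret := round_return (M := M) (r := r) (q := q) (d := d) (b := g x) settled₃
    (List.mem_cons_of_mem _ hx) List.mem_cons_self (by simp [symbol₃]) (by simp [ne])
  refine ⟨_, ((train.tail found).trans grow).tail ret, fun z hz => ?_, fun z hz => ?_,
    fun z hz => h.blank z (mt (List.mem_cons_of_mem _) hz)⟩
  all_goals
    rcases eq_or_ne z (x + step d) with rfl | hzy
    · simp [h.blank _ hy, ne]
    · rcases eq_or_ne z x with rfl | hzx
      · simp [hzy, cap₃]
      · have hz := List.mem_of_ne_of_mem hzy hz
        simp [hzy, hzx, h.symbol_eq z hz, h.cap_eq z hz]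

end Phases

section Simulation

variable {n : ℕ} {M : TM0.Machine Bool (Fin (n + 1))} {r : Rules} {s : State}
  {c c' : TM0.Cfg Bool (Fin (n + 1))}

theorem ShowsTape.exists_extension {J : List ℤ} {t : ℤ → Status} {x : ℤ} {g : ℤ → Bool}
    (h : ShowsTape J t g) (hx : x ∈ J) (q : Fin (n + 1)) (d : Dir) :
    ∃ J' t', ReflTransGen ((game r).Round (table M))
        (modeState (q, d, .run) J t (x + step d) none)
        (modeState (q, d, .run) J' t' (x + step d) none) ∧
      x + step d ∈ J' ∧ ShowsTape J' t' g := by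
  by_cases hy : x + step d ∈ J
  · exact ⟨J, t, .refl, hy, h⟩
  · obtain ⟨t', rounds, shows⟩ := h.exists_settle (M := M) (r := r) (q := q) hx hy
    exact ⟨_, t', rounds, List.mem_cons_self, shows⟩

/-- The state `s` stands for the configuration `c` of a Turing machine: the Worker is at the tape
position `x` of the head. -/
def Represents (c : TM0.Cfg Bool (Fin (n + 1))) (s : State) : Prop :=
  ∃ d J t x, s = modeState (c.q, d, .run) J t x none ∧ x ∈ J ∧
    ShowsTape J t fun z => c.Tape.nth (z - x)

theorem command_of_showsTape {J : List ℤ} {t : ℤ → Status} {x : ℤ} {d : Dir} (hx : x ∈ J)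
    (shows : ShowsTape J t fun z => c.Tape.nth (z - x)) :
    command M ((c.q, d, .run), sight J t x, false) =
      (M c.q c.Tape.head).map fun a => stepOrders c.q d c.Tape.head a.1 a.2 := by
  rw [sight_of_mem hx, shows.symbol_eq x hx, sub_self, Tape.nth_zero]
  rfl

theorem Represents.halt (h : Represents c s) (hstep : TM0.step M c = none) :
    (table M).lookup ((game r).observe s) = none := by
  obtain ⟨d, J, t, x, rfl, hx, shows⟩ := h
  rw [lookup_table, Option.isSome_none, command_of_showsTape hx shows,
    Option.map_eq_none_iff.1 hstep, Option.map_none]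

theorem Represents.move (h : Represents c s) {q : Fin (n + 1)} {d : Dir}
    (hM : M c.q c.Tape.head = some (q, .move d)) :
    ∃ s', TransGen ((game r).Round (table M)) s s' ∧ Represents ⟨q, c.Tape.move d⟩ s' := by
  obtain ⟨d₀, J, t, x, rfl, hx, shows⟩ := h
  have round := round_of_run (M := M) (r := r) (m := (c.q, d₀, .run)) (st := none)
    ((run_moveOrders (x := x) shows.settled d).append
      (run_modeOrder (m' := (q, d, .run)) shows.settled))
    (by rw [Option.isSome_none, command_of_showsTape hx shows, hM]; rfl)
  obtain ⟨J', t', rounds, hy, shows'⟩ := shows.exists_extension (M := M) (r := r) hx q d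
  have tape_eq : (fun z => c.Tape.nth (z - x)) =
      fun z => (c.Tape.move d).nth (z - (x + step d)) := by
    simp only [nth_move, sub_add_eq_sub_sub, sub_add_cancel]
  exact ⟨_, .head' round rounds, d, J', t', _, rfl, hy, tape_eq ▸ shows'⟩

theorem Represents.write (h : Represents c s) {q : Fin (n + 1)} {a : Bool}
    (hM : M c.q c.Tape.head = some (q, .write a)) :
    ∃ s', TransGen ((game r).Round (table M)) s s' ∧ Represents ⟨q, c.Tape.write a⟩ s' := by
  obtain ⟨d, J, t, x, rfl, hx, shows⟩ := h
  have symbol_eq : (t x).symbol = some c.Tape.head := by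
    rw [shows.symbol_eq x hx, sub_self, Tape.nth_zero]
  have settled : Settled J (Function.update t x { t x with symbol := some a }) :=
    shows.settled.update ((shows.settled x hx).set_symbol symbol_eq a)
  have round := round_of_run (M := M) (r := r) (m := (c.q, d, .run)) (st := none)
    ((run_writeOrders shows.settled hx symbol_eq a).append
      (run_modeOrder (m' := (q, d, .run)) settled))
    (by rw [Option.isSome_none, command_of_showsTape hx shows, hM]; rfl)
  refine ⟨_, .single round, d, J, _, x, rfl, hx, fun z hz => ?_, fun z hz => ?_, fun z hz => ?_⟩
  · rcases eq_or_ne z x with rfl | hzx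
    · simp [Tape.write]
    · simp [hzx, sub_eq_zero, shows.symbol_eq z hz]
  · rcases eq_or_ne z x with rfl | hzx
    · simp [shows.cap_eq z hz]
    · simp [hzx, shows.cap_eq z hz]
  · have hzx : z - x ≠ 0 := sub_ne_zero.2 (by rintro rfl; exact hz hx)
    simpa [hzx] using shows.blank z hz

theorem Represents.step (h : Represents c s) (hstep : TM0.step M c = some c') :
    ∃ s', TransGen ((game r).Round (table M)) s s' ∧ Represents c' s' := by
  obtain ⟨⟨q, a⟩, hM, rfl⟩ := Option.map_eq_some_iff.1 hstep
  cases a with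
  | move d => exact h.move hM
  | write a => exact h.write hM

theorem Represents.halts_iff {l : List Bool}
    (h : Represents (TM0.init l : TM0.Cfg Bool (Fin (n + 1))) s) :
    (game r).Halts (table M) s ↔ (TM0.eval M l).Dom :=
  halts_iff_of_simulation (f := TM0.step M) (R := Represents) (fun hstep h => h.step hstep)
    (fun hstep h => h.halt hstep) h

end Simulation

section InitialState

/-- The tape positions that carry the input `l`, and the next one. They start at `1`, so that the
tiles of the Cities have natural first coordinates. -/
def initialPositions (l : List Bool) : List ℤ :=
  (List.range (l.length + 1)).map fun i => ((i + 1 : ℕ) : ℤ)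

/-- The status of the City at the tape position `x` when the tape shows the input `l`. -/
def initialStatus (l : List Bool) (x : ℤ) : Status := ⟨some (l.getI (x.toNat - 1)), 0, some 2, 0⟩

/-- The state with the input `l` on the tape. -/
noncomputable def initialState (n : ℕ) (l : List Bool) : State :=
  modeState ((0 : Fin (n + 1)), .right, .run) (initialPositions l) (initialStatus l) 1 none

variable {n : ℕ} {l : List Bool}

theorem mem_initialPositions {x : ℤ} :
    x ∈ initialPositions l ↔ ∃ i : ℕ, x = i + 1 ∧ i ≤ l.length := by
  simp [initialPositions, and_comm, eq_comm]

theorem showsTape_initialStatus :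
    ShowsTape (initialPositions l) (initialStatus l) fun z => (Tape.mk₁ l).nth (z - 1) where
  symbol_eq x hx := by
    obtain ⟨i, rfl, -⟩ := mem_initialPositions.1 hx
    rw [add_sub_cancel_right, nth_mk₁_natCast]
    rfl
  cap_eq _ _ := rfl
  blank x hx := by
    rcases lt_or_ge (x - 1) 0 with neg | nonneg
    · exact nth_mk₁_of_neg l neg
    · obtain ⟨i, hi⟩ := Int.eq_ofNat_of_zero_le nonneg
      have length_le : l.length ≤ i := by
        by_contra! lt
        exact hx (mem_initialPositions.2 ⟨i, by omega, lt.le⟩)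
      rw [hi, nth_mk₁_natCast, List.getI_eq_default _ length_le]
      rfl

theorem represents_initialState : Represents (TM0.init l : TM0.Cfg Bool (Fin (n + 1)))
    (initialState n l) :=
  ⟨.right, _, _, 1, rfl, mem_initialPositions.2 ⟨0, by simp⟩, showsTape_initialStatus⟩

theorem nodup_sites {J : List ℤ} (h : J.Nodup) : (sites n J).Nodup :=
  .append (h.map Sum.inl_injective) (List.nodup_range.map Sum.inr_injective)
    (by simp [List.disjoint_left])

theorem valid_layout {I : List (ℤ ⊕ ℕ)} {f : ℤ ⊕ ℕ → Status} {w : Hex} {st : Option Hex}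
    (nodup : I.Nodup) (counter_mem : ∀ j < n, .inr j ∈ I) : Valid (layout n I f w st) where
  cities_valid c hc := by
    obtain ⟨p, -, rfl⟩ := List.mem_map.1 hc
    exact (f p).valid_city (site p)
  cities_pairwise := List.pairwise_map.2 <| nodup.imp fun hpq =>
    ⟨four_le_dist_site hpq, fun _ hp hq => hpq (eq_of_mem_cityTiles hp hq)⟩
  disjoint := List.disjoint_nil_right _
  improved h hh := by
    obtain ⟨j, hj, rfl⟩ := List.mem_map.1 (hh.resolve_right List.not_mem_nil)
    refine ⟨by simp [IsGrassland, site, spot], _,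
      List.mem_map.2 ⟨.inr j, counter_mem j (List.mem_range.1 hj), rfl⟩,
      add_spot_mem_cityTiles _ _, add_spot_ne_self _ _⟩

theorem valid_initialState : Valid (initialState n l) :=
  valid_layout
    (nodup_sites (List.nodup_range.map fun i j (h : ((i + 1 : ℕ) : ℤ) = (j + 1 : ℕ)) => by omega))
    fun _ hj => inr_mem_sites.2 hj

theorem primrec_initialCity : Primrec fun p : List Bool × ℕ =>
    (initialStatus p.1 (p.2 + 1 : ℕ)).city (site (.inl (p.2 + 1 : ℕ))) := by
  have primrec_tile (m : ℕ) (y : ℤ) :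
      Primrec fun p : List Bool × ℕ => (((4 * p.2 + m : ℕ) : ℤ), y) :=
    .pair (primrec_intCast.comp
      (Primrec.nat_add.comp (Primrec.nat_mul.comp (.const 4) .snd) (.const m))) (.const y)
  have primrec_tiles : Primrec fun p : List Bool × ℕ =>
      [(4, 0), (5, 0), (3, 0), (5, -1), (4, -1), (4, 1), (3, 1)].map
        fun h : ℕ × ℤ => (((4 * p.2 + h.1 : ℕ) : ℤ), h.2) :=
    Primrec.list_cons.comp (primrec_tile 4 0) <| Primrec.list_cons.comp (primrec_tile 5 0) <|
    Primrec.list_cons.comp (primrec_tile 3 0) <| Primrec.list_cons.comp (primrec_tile 5 (-1)) <|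
    Primrec.list_cons.comp (primrec_tile 4 (-1)) <| Primrec.list_cons.comp (primrec_tile 4 1) <|
    Primrec.list_cons.comp (primrec_tile 3 1) (.const [])
  have primrec_worked : Primrec fun p : List Bool × ℕ =>
      [cond (p.1.getI p.2) (((4 * p.2 + 5 : ℕ) : ℤ), (-1 : ℤ)) (((4 * p.2 + 4 : ℕ) : ℤ), -1)] :=
    Primrec.list_cons.comp (.cond (Primrec.list_getI.comp .fst .snd) (primrec_tile 5 (-1))
      (primrec_tile 4 (-1))) (.const [])
  refine (Primrec.of_equiv_symm (e := City.equiv).comp ((primrec_tile 4 0).pair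
    (primrec_tiles.pair (.pair (.const 2)
      (primrec_worked.pair (.const (0, some 2, 0))))))).of_eq fun p => ?_
  simp only [City.equiv, Status.city, initialStatus, site, cityTiles, Hex.neighbors, HexDir.vec]
  cases h : p.1.getI p.2 <;> simp [h, spot] <;> omega

theorem computable_initialState : Computable (initialState n) := by
  let counter : List City := (List.range (numModes n)).map fun j =>
    (digit (code ((0 : Fin (n + 1)), Dir.right, Phase.run)) j).city (site (.inr j))
  have primrec_equiv : Primrec fun l : List Bool => State.equiv (initialState n l) := by
    refine (Primrec.pair (Primrec.list_append.comp (.list_map (Primrec.list_range.comp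
      (Primrec.succ.comp .list_length)) primrec_initialCity.to₂) (.const counter))
        (.const (monasteries (numModes n), [], post 1, none))).of_eq fun l => ?_
    simp [State.equiv, initialState, modeState, board, layout, sites, initialPositions, counter,
      Function.comp_def]
  exact ((Primrec.of_equiv_symm (e := State.equiv)).comp primrec_equiv).to_comp

theorem exists_simulatesUniversal (r : Rules) :
    ∃ T : CommandTable Obs Order, (game r).SimulatesUniversal T ∧ (game r).UndecidableUnder T :=
  CivGame.exists_simulatesUniversal fun _ M => ⟨table M, initialState _, computable_initialState,
    fun _ => ⟨valid_initialState, represents_initialState.halts_iff⟩⟩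

end InitialState

end CivVI

theorem mainTheorem4 :
    (∀ r : CivBE.Rules, ∃ T : CommandTable (ℕ × CivBE.Improvement) CivBE.Order,
      (CivBE.game r).SimulatesUniversal T ∧ (CivBE.game r).UndecidableUnder T) ∧
    (∀ r : CivV.Rules, ∃ T : CommandTable (ℕ × CivV.Improvement) CivV.Order,
      (CivV.game r).SimulatesUniversal T ∧ (CivV.game r).UndecidableUnder T) ∧
    (∀ r : CivVI.Rules, ∃ T : CommandTable CivVI.Obs CivVI.Order,
      (CivVI.game r).SimulatesUniversal T ∧ (CivVI.game r).UndecidableUnder T) :=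
  ⟨CivBE.exists_simulatesUniversal, CivV.exists_simulatesUniversal,
    CivVI.exists_simulatesUniversal⟩
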